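/- **Setting.** Let $d$ be a dissimilarity on a finite set $X$ ($d(x,y)=d(y,x)\ge 0$, $d(x,x)=0$) and $\epsilon\ge 0$. A total order $\preceq$ on $X$ (or on a subset) is *$c\epsilon$-compatible* if $x\preceq u\preceq v\preceq y$ implies $d(x,y)+2c\epsilon\ge d(u,v)$; $\epsilon$-compatible means $c=1$. *Canonical order.* *Closing* a relation means passing to the least reflexive transitive relation $\preccurlyeq$ containing it such that, whenever $d(x,y)>\max\{d(x,z),d(z,y)\}+2\epsilon$ (so that $z$ must lie between $x$ and $y$) and two of $x,z,y$ are related, the relation extends to the whole triplet, with $z$ in the middle. Start with $s\preccurlyeq t$ for two distinct elements and close. Given a maximal chain $P=(a_1,\dots,a_p)$ of $\preccurlyeq$, adjoin formal elements $a_0$ before and $a_{p+1}$ after everything (with no distances attached). The hole $H_k$ ($0\le k\le p$) is the gap between $a_k$ and $a_{k+1}$. For $x\in X^\circ=X\setminus P$ let $H(x)=H_{ij}$, where $a_i$ is the largest element of the chain with $a_i\preccurlyeq x$ and $a_j$ the smallest with $x\preccurlyeq a_j$; its holes are $H_i,\dots,H_{j-1}$, of which $H_i$ and $H_{j-1}$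 are the *bounding* holes and the others the *inner* holes. A hole $H_k$ of $H(x)$ is *$x$-admissible* if some $\epsilon$-compatible total order on $P\cup\{x\}$ extends $\preccurlyeq$ and puts $x$ in $H_k$. $AH(x)$ is the set of $x$-admissible holes $H_k$ such that for every $y\in X^\circ$, $y\ne x$, there are a $y$-admissible hole $H_{k'}$ and an $\epsilon$-compatible total order on $P\cup\{x,y\}$ extending $\preccurlyeq$ that puts $x$ in $H_k$ and $y$ in $H_{k'}$. If $H(x)=H_{ij}$ and $H_i\notin AH(x)$ (resp. $H_{j-1}\notin AH(x)$), one may add $a_{i+1}\preccurlyeq x$ (resp. $x\preccurlyeq a_{j-1}$) and close again. A *canonical* relation is one obtained by finitely many such steps, each for any maximal chain. Fix a canonical relation $\preccurlyeq$ that is a partial order and a maximal chain $P$ of it such that both bounding holes of $H(x)$ belong to $AH(x)$ for every $x\in X^\circ$. *Cells.* Fix $i,j$ and let $X_{ij}=\{x\in X^\circ: H(x)=H_{ij}\}$. For $x\in X_{ij}$ let $d_x$ be the mean of the minimum and the maximum of $d(x,a_k)$, $i<k<j$. For $x,y\in X_{ij}$ write $xy\in L_{ij}$ if $d(x,y)+3\epsilon<\max\{d_x,d_y\}$,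 and $xy\in S_{ij}$ if $d(x,y)>\max\{d_x,d_y\}+3\epsilon$. *Blocks* are the connected components of $(X_{ij},L_{ij})$. Write $x\rightarrowtail y$ if $d_x+4\epsilon<d_y$, or $d_x\ge d_y-4\epsilon$ and some $z\in X_{ij}$ has $xz,yz\notin L_{ij}$ and $d(x,z)+16\epsilon<d(y,z)$. Write $x\to y$ if $x\rightarrowtail y$ with $x,y$ in a common block, or $d(x,y)+5\epsilon<\max\{d_x,d_y\}$. *Cells* are the strongly connected components of $\to$. *Clusters.* The graph $\mathcal S_{ij}$ joins two distinct cells $C',C''$ if (S1) some $x$ in the block of $C'$ and some $y$ in the block of $C''$ have $xy\in S_{ij}$, or (S2) there are $x,x'$ in the block of $C'$, belonging to a common cell, and $y,y'$ in the block of $C''$, belonging to a common cell other than that of $x,x'$, with $x\rightarrowtail y$ and $y'\rightarrowtail x'$. Two cells are in the same *cluster* if a walk of even length in $\mathcal S_{ij}$ joins them, and in *twin clusters* if a walk of odd length does. (When $\mathcal S_{ij}$ is bipartite, the clusters are the sides of the canonical bipartitions of its connected components.) *Cell graph.* $\mathcal G_{ij}$ is the directed graph on the cells with the following arcs $C'\rightarrowtail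 C$ between distinct cells: (G1) $C',C$ are in twin clusters; (G2) there is no (G1)-arc between $C'$ and $C$, and $d_{x'}+4\epsilon<d_x$ for some $x\in C$, $x'\in C'$; (G3) there is no (G1)- or (G2)-arc between $C'$ and $C$ in either direction, and there are $x\in C$, $x'\in C'$, $z\in X_{ij}$ with $xz,x'z\notin L_{ij}$ and $d(x',z)+16\epsilon<d(x,z)$. A *(G3)-cycle* is a directed cycle all of whose arcs are (G3)-arcs. A *1-cycle* (*2-cycle*) is an induced directed cycle having exactly one (G2)-arc (exactly two (G2)-arcs, and these consecutive), all its other arcs, at least one, being (G3)-arcs. It *intersects* a cluster $\mathcal K$ if the head of one of its (G3)-arcs lies in $\mathcal K$. *Formula.* $\Omega_1(C)$ is the set of (G2)-arcs $C_0\rightarrowtail C$ of 1-cycles intersecting a cluster not containing $C$. $\Omega_2(C)$ is the set of (G2)-arcs $C_0\rightarrowtail C$ of 2-cycles intersecting a cluster not containing $C$ whose arc entering $C_0$ is a (G3)-arc. $\Omega_3(C)$ is the set of (G2)-arcs $C\rightarrowtail C_0$ of 2-cycles intersecting a cluster containing $C$ whose arc entering $C$ is a (G2)-arc. The 2-SAT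 formula $\Phi_{ij}$ has a variable $x_C$ for each cell $C$ and the constraints (F1) $x_{C'}=x_{C''}$ if $C',C''$ are in the same cluster; (F2) $x_{C'}\ne x_{C''}$ if they are in twin clusters; (F3) $x_C\ne x_{C_0}$ if $(C_0\rightarrowtail C)\in\Omega_1(C)\cup\Omega_2(C)$; (F4) $x_C\ne x_{C_0}$ if $(C\rightarrowtail C_0)\in\Omega_3(C)$. Here $a=b$ stands for the clauses $(a\vee\bar b),(\bar a\vee b)$, and $a\neq b$ for $(a\vee b),(\bar a\vee\bar b)$. **Proposition 4.10.** 1. Suppose that $\mathcal G_{ij}$ has no (G3)-cycle and that every cluster induces an acyclic subgraph of $\mathcal G_{ij}$; both hold whenever an $\epsilon$-compatible order on $X$ exists. If $A$ is a satisfying assignment of $\Phi_{ij}$, then $X_{ij}^-=\{C:A(x_C)=0\}$ and $X_{ij}^+=\{C:A(x_C)=1\}$ define a partition of $\mathcal G_{ij}$ into two acyclic induced subgraphs. 2. Every $\epsilon$-compatible order on $X$ refines $\preccurlyeq$ or its dual. Conversely to 1, let an $\epsilon$-compatible order on $X$ be given, directed so that it refines $\preccurlyeq$. Then all elements of a cell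 are located in one and the same hole of $H_{ij}$. Consider the assignments $A$ with $A(x_C)=0$ if $C$ is located in $H_i$, $A(x_C)=1$ if $C$ is located in $H_{j-1}$, and $A(x_{C'})=A(x_{C''})$ if $C',C''$ are located in a common inner hole. Such assignments exist, and each of them satisfies $\Phi_{ij}$. 3. In particular, if $\Phi_{ij}$ is not satisfiable, then no $\epsilon$-compatible order on $X$ exists. -/

import Mathlib

namespace SeriationFit

/-! ## Dissimilarities and compatible orders -/

/-- A dissimilarity: symmetric, nonnegative, zero on the diagonal. -/
structure IsDissimilarity {X : Type*} (d : X → X → ℝ) : Prop where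
  symm : ∀ x y, d x y = d y x
  nonneg : ∀ x y, 0 ≤ d x y
  self : ∀ x, d x x = 0

/-- The (reflexive) total order `le` is `ε`-compatible with `d` on the subset `Q`:
`x ≼ u ≼ v ≼ y` implies `d x y + 2 ε ≥ d u v`. -/
def CompatOn {X : Type*} (d : X → X → ℝ) (ε : ℝ) (Q : Set X) (le : X → X → Prop) : Prop :=
  ∀ x ∈ Q, ∀ u ∈ Q, ∀ v ∈ Q, ∀ y ∈ Q, le x u → le u v → le v y → d u v ≤ d x y + 2 * ε

/-- `le` is an `ε`-compatible total order on the whole of `X`. -/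
def IsCompatibleOrder {X : Type*} (d : X → X → ℝ) (ε : ℝ) (le : X → X → Prop) : Prop :=
  IsLinearOrder X le ∧ CompatOn d ε Set.univ le

/-- `le` extends `R` on the subset `Q`. -/
def ExtendsOn {X : Type*} (Q : Set X) (R le : X → X → Prop) : Prop :=
  ∀ x ∈ Q, ∀ y ∈ Q, R x y → le x y

/-! ## The canonical order -/

/-- `d x y > max (d x z) (d z y) + 2 ε`: in all `ε`-compatible orders `z` lies between
`x` and `y`. -/
def MustBetween {X : Type*} (d : X → X → ℝ) (ε : ℝ) (x z y : X) : Prop :=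
  max (d x z) (d z y) + 2 * ε < d x y

/-- The least preorder containing `S` which is closed under the betweenness observation: if `z`
must be between `x` and `y` and two elements of the triplet are related, then the relation is
extended to the whole triplet. (The remaining cases are these, with `x` and `y` exchanged.) -/
inductive Closure {X : Type*} (d : X → X → ℝ) (ε : ℝ) (S : X → X → Prop) : X → X → Prop
  | base {x y : X} : S x y → Closure d ε S x y
  | refl (x : X) : Closure d ε S x x
  | trans {x y z : X} : Closure d ε S x y → Closure d ε S y z → Closure d ε S x z
  | middle_right {x z y : X} : MustBetween d ε x z y → Closure d ε S x z → Closure d ε S z y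
  | middle_left {x z y : X} : MustBetween d ε x z y → Closure d ε S z x → Closure d ε S y z
  | ends_left {x z y : X} : MustBetween d ε x z y → Closure d ε S x y → Closure d ε S x z
  | ends_right {x z y : X} : MustBetween d ε x z y → Closure d ε S x y → Closure d ε S z y

/-! ## Chains, holes, admissible holes

A chain `a_1 ≼ … ≼ a_p` is a map `a : Fin p → X`, so that `a_k` is `a` at the index `k - 1`.
Two artificial elements `a_0` (before everything) and `a_{p+1}` (after everything) are adjoined,
purely formally: no distance is attached to them.
For `0 ≤ k ≤ p` the hole `H_k` lies between `a_k` and `a_{k+1}`. -/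

/-- `a` lists a maximal chain of `R` in increasing order. -/
def IsMaximalChain {X : Type*} (R : X → X → Prop) {p : ℕ} (a : Fin p → X) : Prop :=
  (∀ m n : Fin p, R (a m) (a n) ↔ m ≤ n) ∧ IsMaxChain R (Set.range a)

/-- `H(x) = H_{ij}`: `a_i` is the largest (possibly artificial) element of the chain below `x`
and `a_j` is the smallest one above `x`. -/
def HasSegment {X : Type*} (R : X → X → Prop) {p : ℕ} (a : Fin p → X) (x : X) (i j : ℕ) : Prop :=
  j ≤ p + 1 ∧ (∀ m : Fin p, R (a m) x ↔ m.val + 1 ≤ i) ∧ (∀ m : Fin p, R x (a m) ↔ j ≤ m.val + 1)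

/-- In the order `le` the element `x` is located in the hole `H_k`. -/
def InHole {X : Type*} {p : ℕ} (a : Fin p → X) (le : X → X → Prop) (x : X) (k : ℕ) : Prop :=
  ∀ m : Fin p, (m.val + 1 ≤ k → le (a m) x) ∧ (k < m.val + 1 → le x (a m))

/-- The hole `H_k` is `x`-admissible: `H_k` is a hole of `H(x)` and the total order on `P ∪ {x}`
that extends `R` and puts `x` in `H_k` is `ε`-compatible. -/
def Admissible {X : Type*} (d : X → X → ℝ) (ε : ℝ) (R : X → X → Prop) {p : ℕ} (a : Fin p → X)
    (x : X) (k : ℕ) : Prop :=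
  (∃ i j, HasSegment R a x i j ∧ i ≤ k ∧ k < j) ∧
  ∃ le : X → X → Prop, IsLinearOrder X le ∧ ExtendsOn (Set.range a ∪ {x}) R le ∧
    InHole a le x k ∧ CompatOn d ε (Set.range a ∪ {x}) le

/-- The pair `H_k, H_k'` of holes is `(x, y, c)`-admissible. -/
def PairAdmissible {X : Type*} (d : X → X → ℝ) (ε : ℝ) (R : X → X → Prop) {p : ℕ} (a : Fin p → X)
    (x y : X) (c : ℝ) (k k' : ℕ) : Prop :=
  Admissible d ε R a x k ∧ Admissible d ε R a y k' ∧
  ∃ le : X → X → Prop, IsLinearOrder X le ∧ ExtendsOn (Set.range a ∪ {x, y}) R le ∧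
    InHole a le x k ∧ InHole a le y k' ∧ CompatOn d (c * ε) (Set.range a ∪ {x, y}) le

/-- `H_k ∈ AH(x)`: the hole `H_k` is `x`-admissible, and every other element `y` off the chain has
a `y`-admissible hole that forms with it an `(x, y, 1)`-admissible pair. -/
def InAH {X : Type*} (d : X → X → ℝ) (ε : ℝ) (R : X → X → Prop) {p : ℕ} (a : Fin p → X)
    (x : X) (k : ℕ) : Prop :=
  Admissible d ε R a x k ∧
  ∀ y, y ∉ Set.range a → y ≠ x → ∃ k', PairAdmissible d ε R a x y 1 k k'

/-- The canonical relations: start from `s ≼ t` for two distinct elements `s, t` and close;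
then, any number of times, pick a maximal chain and an element `x` off it such that one of the two
bounding holes `H_i`, `H_{j-1}` of `H(x) = H_{ij}` is not in `AH(x)`, add `a_{i+1} ≼ x`
(respectively `x ≼ a_{j-1}`), and close again. -/
inductive IsCanonical {X : Type*} (d : X → X → ℝ) (ε : ℝ) : (X → X → Prop) → Prop
  | init (s t : X) (hst : s ≠ t) : IsCanonical d ε (Closure d ε (fun u v => u = s ∧ v = t))
  | augment_left {R : X → X → Prop} {p : ℕ} {a : Fin p → X} {x : X} {i j : ℕ} (m : Fin p) :
      IsCanonical d ε R → IsMaximalChain R a → x ∉ Set.range a → HasSegment R a x i j →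
      ¬ InAH d ε R a x i → m.val = i →
      IsCanonical d ε (Closure d ε (fun u v => R u v ∨ (u = a m ∧ v = x)))
  | augment_right {R : X → X → Prop} {p : ℕ} {a : Fin p → X} {x : X} {i j : ℕ} (m : Fin p) :
      IsCanonical d ε R → IsMaximalChain R a → x ∉ Set.range a → HasSegment R a x i j →
      ¬ InAH d ε R a x (j - 1) → m.val + 2 = j →
      IsCanonical d ε (Closure d ε (fun u v => R u v ∨ (u = x ∧ v = a m)))

/-- Both bounding holes of every `x` off the chain belong to `AH(x)`. -/
def BoundingHolesAdmissible {X : Type*} (d : X → X → ℝ) (ε : ℝ) (R : X → X → Prop) {p : ℕ}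
    (a : Fin p → X) : Prop :=
  ∀ x, x ∉ Set.range a → ∀ i j, HasSegment R a x i j →
    InAH d ε R a x i ∧ InAH d ε R a x (j - 1)

/-! ## Blocks, cells, clusters and the cell graph

These depend only on the set `X_{ij}`, the distances between its elements, the numbers `d_x`
and `ε`. -/

/-- A set with pairwise distances `dist x y`, numbers `mean x` (the `d_x`) and a tolerance. -/
structure LocalData (Y : Type*) where
  dist : Y → Y → ℝ
  mean : Y → ℝ
  ε : ℝ

namespace LocalData

/-- `xy ∈ L_{ij}`. -/
def Link {Y : Type*} (T : LocalData Y) (x y : Y) : Prop :=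
  T.dist x y + 3 * T.ε < max (T.mean x) (T.mean y)

/-- `xy ∈ S_{ij}`. -/
def Sep {Y : Type*} (T : LocalData Y) (x y : Y) : Prop :=
  max (T.mean x) (T.mean y) + 3 * T.ε < T.dist x y

/-- `x` and `y` belong to the same block, i.e. connected component of the graph of linked pairs. -/
def SameBlock {Y : Type*} (T : LocalData Y) : Y → Y → Prop :=
  Relation.EqvGen T.Link

/-- The relation `x ↣ y` on elements. -/
def Tail {Y : Type*} (T : LocalData Y) (x y : Y) : Prop :=
  T.mean x + 4 * T.ε < T.mean y ∨
  (T.mean y - 4 * T.ε ≤ T.mean x ∧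
    ∃ z, ¬ T.Link x z ∧ ¬ T.Link y z ∧ T.dist x z + 16 * T.ε < T.dist y z)

/-- The arcs `x → y` of the directed graph on elements. -/
def ElemArc {Y : Type*} (T : LocalData Y) (x y : Y) : Prop :=
  (T.Tail x y ∧ T.SameBlock x y) ∨ T.dist x y + 5 * T.ε < max (T.mean x) (T.mean y)

/-- Mutual reachability along the arcs `x → y`. -/
def cellSetoid {Y : Type*} (T : LocalData Y) : Setoid Y where
  r x y := Relation.ReflTransGen T.ElemArc x y ∧ Relation.ReflTransGen T.ElemArc y x
  iseqv :=
    { refl := fun _ => ⟨.refl, .refl⟩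
      symm := fun h => ⟨h.2, h.1⟩
      trans := fun h h' => ⟨h.1.trans h'.1, h'.2.trans h.2⟩ }

/-- Cells: strongly connected components. -/
abbrev Cell {Y : Type*} (T : LocalData Y) : Type _ := Quotient T.cellSetoid

/-- The cell of an element. -/
def cellOf {Y : Type*} (T : LocalData Y) (x : Y) : T.Cell := Quotient.mk T.cellSetoid x

/-- The element `x` belongs to the same block as the cell `C`. -/
def InBlockOf {Y : Type*} (T : LocalData Y) (x : Y) (C : T.Cell) : Prop :=
  ∃ u, T.cellOf u = C ∧ T.SameBlock u x

/-- Condition (S1). -/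
def S1 {Y : Type*} (T : LocalData Y) (C' C'' : T.Cell) : Prop :=
  ∃ x y, T.InBlockOf x C' ∧ T.InBlockOf y C'' ∧ T.Sep x y

/-- Condition (S2). The cell containing `x, x'` and the cell containing `y, y'` are distinct. -/
def S2 {Y : Type*} (T : LocalData Y) (C' C'' : T.Cell) : Prop :=
  ∃ x x' y y', T.InBlockOf x C' ∧ T.InBlockOf x' C' ∧ T.InBlockOf y C'' ∧ T.InBlockOf y' C'' ∧
    T.cellOf x = T.cellOf x' ∧ T.cellOf y = T.cellOf y' ∧ T.cellOf x ≠ T.cellOf y ∧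
    T.Tail x y ∧ T.Tail y' x'

/-- The graph of separated cells (a simple graph: distinct cells, symmetrized). -/
def sepGraph {Y : Type*} (T : LocalData Y) : SimpleGraph T.Cell :=
  SimpleGraph.fromRel (fun C' C'' => T.S1 C' C'' ∨ T.S2 C' C'')

/-- The two cells belong to the same cluster: they are in one connected component of the separation
graph, on the same side of its canonical bipartition. -/
def SameCluster {Y : Type*} (T : LocalData Y) (C' C'' : T.Cell) : Prop :=
  ∃ w : T.sepGraph.Walk C' C'', Even w.length

/-- The two cells belong to twin clusters: they are in one connected component of the separation
graph, on different sides of its canonical bipartition. -/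
def TwinClusters {Y : Type*} (T : LocalData Y) (C' C'' : T.Cell) : Prop :=
  ∃ w : T.sepGraph.Walk C' C'', Odd w.length

/-- A cluster, as a set of cells. -/
def IsCluster {Y : Type*} (T : LocalData Y) (K : Set T.Cell) : Prop :=
  ∃ C, K = {C' | T.SameCluster C C'}

/-- (G1)-arcs, from `C'` to `C`. -/
def G1 {Y : Type*} (T : LocalData Y) (C' C : T.Cell) : Prop :=
  C' ≠ C ∧ T.TwinClusters C' C

/-- (G2)-arcs, from `C'` to `C`. -/
def G2 {Y : Type*} (T : LocalData Y) (C' C : T.Cell) : Prop :=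
  C' ≠ C ∧ ¬ T.G1 C' C ∧ ¬ T.G1 C C' ∧
  ∃ x x', T.cellOf x = C ∧ T.cellOf x' = C' ∧ T.mean x' + 4 * T.ε < T.mean x

/-- (G3)-arcs, from `C'` to `C`. -/
def G3 {Y : Type*} (T : LocalData Y) (C' C : T.Cell) : Prop :=
  C' ≠ C ∧ ¬ T.G1 C' C ∧ ¬ T.G1 C C' ∧ ¬ T.G2 C' C ∧ ¬ T.G2 C C' ∧
  ∃ x x' z, T.cellOf x = C ∧ T.cellOf x' = C' ∧ ¬ T.Link x z ∧ ¬ T.Link x' z ∧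
    T.dist x' z + 16 * T.ε < T.dist x z

/-- The arcs `C' ↣ C` of the cell graph. -/
def Arc {Y : Type*} (T : LocalData Y) (C' C : T.Cell) : Prop :=
  T.G1 C' C ∨ T.G2 C' C ∨ T.G3 C' C

/-- The subgraph of the cell graph induced by `V` has no directed cycle. -/
def AcyclicOn {Y : Type*} (T : LocalData Y) (V : Set T.Cell) : Prop :=
  ∀ C, ¬ Relation.TransGen (fun C' C'' => C' ∈ V ∧ C'' ∈ V ∧ T.Arc C' C'') C C

/-- There is no directed cycle that consists of (G3)-arcs. -/
def NoG3Cycle {Y : Type*} (T : LocalData Y) : Prop :=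
  ∀ C, ¬ Relation.TransGen T.G3 C C

/-- `c 0 ↣ c 1 ↣ … ↣ c (n - 1) ↣ c 0` is an induced directed cycle. -/
def IsInducedCycle {Y : Type*} (T : LocalData Y) {n : ℕ} (c : ZMod n → T.Cell) : Prop :=
  2 ≤ n ∧ Function.Injective c ∧ ∀ s t, T.Arc (c s) (c t) ↔ t = s + 1

/-- An induced 1-cycle: one (G2)-arc, all other arcs are (G3)-arcs. -/
def IsOneCycle {Y : Type*} (T : LocalData Y) {n : ℕ} (c : ZMod n → T.Cell) : Prop :=
  T.IsInducedCycle c ∧ ∃ s₀, T.G2 (c s₀) (c (s₀ + 1)) ∧ ∀ s, s ≠ s₀ → T.G3 (c s) (c (s + 1))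

/-- An induced 2-cycle: two consecutive (G2)-arcs, all other arcs are (G3)-arcs, and there is at
least one of these. -/
def IsTwoCycle {Y : Type*} (T : LocalData Y) {n : ℕ} (c : ZMod n → T.Cell) : Prop :=
  3 ≤ n ∧ T.IsInducedCycle c ∧ ∃ s₀, T.G2 (c s₀) (c (s₀ + 1)) ∧ T.G2 (c (s₀ + 1)) (c (s₀ + 2)) ∧
    ∀ s, s ≠ s₀ → s ≠ s₀ + 1 → T.G3 (c s) (c (s + 1))

/-- The cycle `c` intersects the cluster `K`: the head of a (G3)-arc of `c` lies in `K`. -/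
def Intersects {Y : Type*} (T : LocalData Y) {n : ℕ} (c : ZMod n → T.Cell) (K : Set T.Cell) :
    Prop :=
  ∃ s, T.G3 (c s) (c (s + 1)) ∧ c (s + 1) ∈ K

/-- The tails `C₀` of the (G2)-arcs `C₀ ↣ C` in `Ω₁(C)`. -/
def Omega1 {Y : Type*} (T : LocalData Y) (C : T.Cell) : Set T.Cell :=
  {C₀ | ∃ (n : ℕ) (c : ZMod n → T.Cell) (K : Set T.Cell) (s : ZMod n),
    T.IsOneCycle c ∧ T.IsCluster K ∧ C ∉ K ∧ T.Intersects c K ∧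
    c s = C₀ ∧ c (s + 1) = C ∧ T.G2 C₀ C}

/-- The tails `C₀` of the (G2)-arcs `C₀ ↣ C` in `Ω₂(C)`. -/
def Omega2 {Y : Type*} (T : LocalData Y) (C : T.Cell) : Set T.Cell :=
  {C₀ | ∃ (n : ℕ) (c : ZMod n → T.Cell) (K : Set T.Cell) (s : ZMod n),
    T.IsTwoCycle c ∧ T.IsCluster K ∧ C ∉ K ∧ T.Intersects c K ∧
    c s = C₀ ∧ c (s + 1) = C ∧ T.G2 C₀ C ∧ T.G3 (c (s - 1)) C₀}

/-- The heads `C₀` of the (G2)-arcs `C ↣ C₀` in `Ω₃(C)`. -/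
def Omega3 {Y : Type*} (T : LocalData Y) (C : T.Cell) : Set T.Cell :=
  {C₀ | ∃ (n : ℕ) (c : ZMod n → T.Cell) (K : Set T.Cell) (s : ZMod n),
    T.IsTwoCycle c ∧ T.IsCluster K ∧ C ∈ K ∧ T.Intersects c K ∧
    c s = C ∧ c (s + 1) = C₀ ∧ T.G2 C C₀ ∧ T.G2 (c (s - 1)) C}

end LocalData

/-! ## 2-SAT formulas -/

/-- A literal: `(v, true)` is the variable `v`, and `(v, false)` is its negation. -/
abbrev Literal (V : Type*) := V × Bool

/-- A 2-SAT formula: a set of clauses with two literals each. -/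
abbrev TwoSAT (V : Type*) := Set (Literal V × Literal V)

/-- The assignment `A` satisfies every clause of `Φ`. -/
def Satisfies {V : Type*} (A : V → Bool) (Φ : TwoSAT V) : Prop :=
  ∀ κ ∈ Φ, A κ.1.1 = κ.1.2 ∨ A κ.2.1 = κ.2.2

/-- The constraint `u = v` as the two clauses `u ∨ ¬v` and `¬u ∨ v`. -/
def eqClauses {V : Type*} (u v : V) : TwoSAT V :=
  {((u, true), (v, false)), ((u, false), (v, true))}

/-- The constraint `u ≠ v` as the two clauses `u ∨ v` and `¬u ∨ ¬v`. -/
def neClauses {V : Type*} (u v : V) : TwoSAT V :=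
  {((u, true), (v, true)), ((u, false), (v, false))}

/-- The 2-SAT formula with one variable for each cell and the constraints (F1)-(F4). -/
def LocalData.formula {Y : Type*} (T : LocalData Y) : TwoSAT T.Cell :=
  {κ | (∃ C' C'', T.SameCluster C' C'' ∧ κ ∈ eqClauses C' C'') ∨
    (∃ C' C'', T.TwinClusters C' C'' ∧ κ ∈ neClauses C' C'') ∨
    (∃ C C₀, C₀ ∈ T.Omega1 C ∪ T.Omega2 C ∧ κ ∈ neClauses C C₀) ∨
    (∃ C C₀, C₀ ∈ T.Omega3 C ∧ κ ∈ neClauses C C₀)}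

/-! ## The sets `X_{ij}` -/

/-- `X_{ij}`: the elements `x` off the chain with `H(x) = H_{ij}`. -/
abbrev Xset {X : Type*} (R : X → X → Prop) {p : ℕ} (a : Fin p → X) (i j : ℕ) : Type _ :=
  {x : X // x ∉ Set.range a ∧ HasSegment R a x i j}

/-- The distances from `x` to the elements `a_k` with `i < k < j`. -/
def innerDistances {X : Type*} (d : X → X → ℝ) {p : ℕ} (a : Fin p → X) (i j : ℕ) (x : X) :
    Set ℝ :=
  {t | ∃ m : Fin p, i < m.val + 1 ∧ m.val + 1 < j ∧ t = d x (a m)}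

/-- The data on `X_{ij}`: the distances, the numbers `d_x` (the mean of the minimum and the maximum
of a set of distances that is finite and, for a maximal chain, nonempty), and `ε`. -/
noncomputable def localData {X : Type*} (d : X → X → ℝ) (ε : ℝ) (R : X → X → Prop) {p : ℕ}
    (a : Fin p → X) (i j : ℕ) : LocalData (Xset R a i j) where
  dist x y := d x.1 y.1
  mean x := (sInf (innerDistances d a i j x.1) + sSup (innerDistances d a i j x.1)) / 2
  ε := ε

/-- In the order `le`, all elements of the cell `C` are located in the hole `H_k`. -/
def CellInHole {X : Type*} {d : X → X → ℝ} {ε : ℝ} {R : X → X → Prop} {p : ℕ}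
    {a : Fin p → X} {i j : ℕ} (le : X → X → Prop) (C : (localData d ε R a i j).Cell) (k : ℕ) :
    Prop :=
  ∀ x, (localData d ε R a i j).cellOf x = C → InHole a le x.1 k

/-- The assignment `A` is one defined by the order `le`: it is `0` on the cells located in `H_i`,
`1` on the cells located in `H_{j-1}`, and equal on any two cells located in a common inner hole. -/
def IsInducedAssignment {X : Type*} {d : X → X → ℝ} {ε : ℝ} {R : X → X → Prop} {p : ℕ}
    {a : Fin p → X} {i j : ℕ} (le : X → X → Prop) (A : (localData d ε R a i j).Cell → Bool) :
    Prop :=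
  (∀ C, CellInHole le C i → A C = false) ∧
  (∀ C, CellInHole le C (j - 1) → A C = true) ∧
  (∀ C' C'' k, i < k → k < j - 1 → CellInHole le C' k → CellInHole le C'' k → A C' = A C'')

end SeriationFit

open SeriationFit

/-! A directed graph with a cycle has an induced cycle, so for the first claim it suffices that no
induced cycle runs through cells of equal value (`no_induced_cycle`). Such a cycle has no (G1)-arc,
and adding up the inequalities between means given by its (G2)-arcs and by the missing chords shows
that any two of its (G2)-arcs are consecutive. Hence it is a (G3)-cycle, a 1-cycle or a 2-cycle. A
1-cycle on which no `Omega1` constraint acts lies inside one cluster. In a 2-cycle the tail of the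
first (G2)-arc is the head of a (G3)-arc; if it shares the cluster of the middle cell, `Omega3` cuts
the second (G2)-arc, otherwise `Omega2` cuts the first.

In the other direction, admissibility of both bounding holes makes all distances from `x` to the
inner chain elements equal to `d_x` up to `ε` (`dist_chain_mem`). In a compatible order, linked
elements therefore share a hole, separated ones lie in opposite bounding holes, and arcs inside a
bounding hole point outwards. `Placement` records these facts, and the analysis of cells uses
nothing else. A closed walk of outward steps in one bounding hole stays in one cell, so (G2)- and
(G3)-arcs cannot form a cycle there (`acyclic_side`). Along a path of (G3)-arcs all heads share one
bounding hole (`cellSide_of_g3_g3`). Thus some (G2)-arc of a 1-cycle or 2-cycle joins opposite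
bounding holes, and the cluster conditions tell which one: this is what (F3) and (F4) require.

Finally, a hole in which a compatible order places `x` always belongs to `AH(x)`, so each
augmentation of the canonical relation is forced once the direction of the order is fixed. -/

namespace SeriationFit

/-! ### Elements of `X_{ij}`: blocks, sides and the direction of tails. -/

namespace LocalData

/-- The facts on the location of the elements of `X_{ij}` in a compatible order on which the
analysis of cells relies: `side b x` says that `x` is in the first (`b = false`) or the last
(`b = true`) bounding hole, and `out b x y` that `y` comes strictly after `x` when one moves
towards that end of the order. -/
structure Placement {Y : Type*} (T : LocalData Y) (side : Bool → Y → Prop)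
    (out : Bool → Y → Y → Prop) : Prop where
  eps_nonneg : 0 ≤ T.ε
  symm : ∀ x y, T.dist x y = T.dist y x
  out_asymm : ∀ b x y, out b x y → ¬ out b y x
  out_trans : ∀ b x y z, out b x y → out b y z → out b x z
  out_total : ∀ b x y, out b x y ∨ x = y ∨ out b y x
  between_left : ∀ b u w v, out b u w → out b w v → T.dist u w ≤ T.dist u v + 2 * T.ε
  between_right : ∀ b u w v, out b u w → out b w v → T.dist w v ≤ T.dist u v + 2 * T.ε
  side_disjoint : ∀ b x, side b x → ¬ side (!b) x
  side_of_link : ∀ b x y, T.Link x y → side b x → side b y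
  side_of_sep : ∀ x y, T.Sep x y → ∃ b, side b x ∧ side (!b) y
  side_of_mean : ∀ x y, T.mean x + 4 * T.ε < T.mean y → ∃ b, side b y
  mean_le : ∀ b x y, side b x → side b y → out b x y → T.mean x ≤ T.mean y + 4 * T.ε
  cross : ∀ b w x y, side (!b) w → side b x → side b y → out b x y →
    T.dist w x ≤ T.dist w y + 2 * T.ε

theorem cellOf_eq_iff {Y : Type*} {T : LocalData Y} {x y : Y} : T.cellOf x = T.cellOf y ↔
    Relation.ReflTransGen T.ElemArc x y ∧ Relation.ReflTransGen T.ElemArc y x :=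
  Quotient.eq (r := T.cellSetoid)

theorem exists_cellOf_eq {Y : Type*} {T : LocalData Y} (C : T.Cell) : ∃ x, T.cellOf x = C :=
  Quotient.exists_rep C

theorem Sep.symm_of {Y : Type*} {T : LocalData Y} (hs : ∀ x y, T.dist x y = T.dist y x) {x y : Y}
    (h : T.Sep x y) : T.Sep y x := by
  unfold Sep at *
  rw [max_comm, hs y x]
  exact h

/-- Without (G1)- and (G2)-arcs the means of the head do not exceed those of the tail by more than
`4 ε`. -/
theorem mean_le_of_not_g2 {Y : Type*} {T : LocalData Y} {C' C : T.Cell} (hne : C' ≠ C)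
    (h1 : ¬ T.G1 C' C) (h1' : ¬ T.G1 C C') (h2 : ¬ T.G2 C' C) {x x' : Y} (hx : T.cellOf x = C)
    (hx' : T.cellOf x' = C') : T.mean x ≤ T.mean x' + 4 * T.ε := by
  by_contra h
  exact h2 ⟨hne, h1, h1', x, x', hx, hx', not_le.mp h⟩

theorem twinClusters_symm {Y : Type*} {T : LocalData Y} {C' C : T.Cell}
    (h : T.TwinClusters C' C) : T.TwinClusters C C' := by
  obtain ⟨w, hw⟩ := h
  exact ⟨w.reverse, by simpa using hw⟩

theorem g1_symm {Y : Type*} {T : LocalData Y} {C' C : T.Cell} (h : T.G1 C' C) : T.G1 C C' :=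
  ⟨h.1.symm, twinClusters_symm h.2⟩

theorem sameCluster_symm {Y : Type*} {T : LocalData Y} {C' C : T.Cell}
    (h : T.SameCluster C' C) : T.SameCluster C C' := by
  obtain ⟨w, hw⟩ := h
  exact ⟨w.reverse, by simpa using hw⟩

/-- For a (G3)-arc the absence of a (G2)-arc supplies the condition on means in the second
alternative of `Tail`. -/
theorem g2_or_g3_tail {Y : Type*} {T : LocalData Y} {C' C : T.Cell} (h : T.G2 C' C ∨ T.G3 C' C) :
    ∃ x' x, T.cellOf x' = C' ∧ T.cellOf x = C ∧ T.Tail x' x := by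
  rcases h with ⟨-, -, -, x, x', hx, hx', h⟩ | ⟨hne, h1, h1', h2, -, x, x', z, hx, hx', hz, hz', h⟩
  · exact ⟨x', x, hx', hx, Or.inl h⟩
  · have := mean_le_of_not_g2 hne h1 h1' h2 hx hx'
    exact ⟨x', x, hx', hx, Or.inr ⟨by linarith, z, hz', hz, h⟩⟩

/-- The element `z` of a (G3)-arc is far beyond separation from the head of the arc. -/
theorem g3_witness {Y : Type*} {T : LocalData Y} {C' C : T.Cell} (h : T.G3 C' C) :
    ∃ x' x z, T.cellOf x' = C' ∧ T.cellOf x = C ∧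
      max (T.mean x') (T.mean z) + 13 * T.ε < T.dist x z := by
  obtain ⟨-, -, -, -, -, x, x', z, hx, hx', -, hz', h⟩ := h
  refine ⟨x', x, z, hx', hx, ?_⟩
  have := not_lt.mp hz'
  linarith

namespace Placement

variable {Y : Type*} {T : LocalData Y} {side : Bool → Y → Prop} {out : Bool → Y → Y → Prop}

theorem out_irrefl (P : Placement T side out) {b : Bool} {x : Y} : ¬ out b x x :=
  fun h => P.out_asymm b x x h h

theorem link_of_strong (P : Placement T side out) {x y : Y}
    (h : T.dist x y + 5 * T.ε < max (T.mean x) (T.mean y)) : T.Link x y := by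
  have := P.eps_nonneg
  unfold Link
  linarith

theorem link_symm (P : Placement T side out) {x y : Y} (h : T.Link x y) : T.Link y x := by
  unfold Link at *
  rw [max_comm, P.symm y x]
  exact h

theorem side_of_sameBlock (P : Placement T side out) {b : Bool} {x y : Y} (h : T.SameBlock x y) :
    side b x ↔ side b y := by
  induction h with
  | rel x y h => exact ⟨P.side_of_link b x y h, P.side_of_link b y x (P.link_symm h)⟩
  | refl x => rfl
  | symm x y _ ih => exact ih.symm
  | trans x y z _ _ ih ih' => exact ih.trans ih'

theorem sameBlock_of_elemArc (P : Placement T side out) {x y : Y} (h : T.ElemArc x y) :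
    T.SameBlock x y := by
  rcases h with h | h
  · exact h.2
  · exact .rel _ _ (P.link_of_strong h)

theorem sameBlock_of_reach (P : Placement T side out) {x y : Y}
    (h : Relation.ReflTransGen T.ElemArc x y) : T.SameBlock x y := by
  induction h with
  | refl => exact .refl _
  | tail _ h ih => exact .trans _ _ _ ih (P.sameBlock_of_elemArc h)

theorem sameBlock_of_cellOf_eq (P : Placement T side out) {x y : Y}
    (h : T.cellOf x = T.cellOf y) : T.SameBlock x y :=
  P.sameBlock_of_reach (cellOf_eq_iff.mp h).1

/-- Between the ends of a strong link there are no elements of other blocks. -/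
theorem sameBlock_of_between (P : Placement T side out) {b : Bool} {u w v : Y} (h : out b u w)
    (h' : out b w v) (hl : T.dist u v + 5 * T.ε < max (T.mean u) (T.mean v)) :
    T.SameBlock u w := by
  -- Compatibility costs `2 ε` of the margin `5 ε`. The remaining `3 ε` link `w` to whichever end
  -- has the larger mean.
  have h1 := P.between_left b u w v h h'
  have h2 := P.between_right b u w v h h'
  rcases le_total (T.mean u) (T.mean v) with hm | hm
  · have : T.Link w v := by
      unfold Link
      rw [max_eq_right hm] at hl
      have := le_max_right (T.mean w) (T.mean v)
      linarith
    exact .trans _ _ _ (.rel _ _ (P.link_of_strong hl)) (.symm _ _ (.rel _ _ this))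
  · refine .rel _ _ ?_
    unfold Link
    rw [max_eq_left hm] at hl
    have := le_max_left (T.mean u) (T.mean w)
    linarith

/-- The missing link bounds both means at `x` and `z` by `d(x,z) + 3 ε`, and passing from `x` to `y`
costs `4 ε` more. The gap of `16 ε` leaves a margin above the `3 ε` of separation. -/
theorem sep_of_tail_witness (P : Placement T side out) {x y z : Y}
    (hm : T.mean y - 4 * T.ε ≤ T.mean x) (hx : ¬ T.Link x z)
    (h : T.dist x z + 16 * T.ε < T.dist y z) : T.Sep y z := by
  have := P.eps_nonneg
  have h1 := not_lt.mp hx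
  have h2 := le_max_left (T.mean x) (T.mean z)
  have h3 := le_max_right (T.mean x) (T.mean z)
  unfold Sep
  have : max (T.mean y) (T.mean z) ≤ max (T.mean x) (T.mean z) + 4 * T.ε :=
    max_le (by linarith) (by linarith)
  linarith

/-- The head of an arc is never located in an inner hole. -/
theorem side_of_tail (P : Placement T side out) {x y : Y} (h : T.Tail x y) : ∃ b, side b y := by
  rcases h with h | ⟨hm, z, hx, -, h⟩
  · exact P.side_of_mean _ _ h
  · obtain ⟨b, hb, -⟩ := P.side_of_sep _ _ (P.sep_of_tail_witness hm hx h)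
    exact ⟨b, hb⟩

/-- An inward tail is impossible: in its first form it contradicts the monotonicity of means, and in
its second form `z` lies in the opposite bounding hole, from where the outer element `x` cannot be
nearer than `y` by more than `2 ε`. -/
theorem out_of_tail (P : Placement T side out) {b : Bool} {x y : Y} (hx : side b x)
    (hy : side b y) (h : T.Tail x y) : out b x y := by
  have hε := P.eps_nonneg
  rcases P.out_total b x y with ho | rfl | ho
  · exact ho
  · exfalso
    rcases h with h | ⟨-, z, -, -, h⟩ <;> linarith
  · exfalso
    rcases h with h | ⟨hm, z, hxz, -, h⟩
    · have := P.mean_le b y x hy hx ho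
      linarith
    · obtain ⟨b', hb, hb'⟩ := P.side_of_sep _ _ (P.sep_of_tail_witness hm hxz h)
      have : b' = b := by
        by_contra hne
        exact P.side_disjoint b y hy (by rwa [← Bool.eq_not_of_ne hne])
      subst this
      have := P.cross b' z y x hb' hy hx ho
      rw [P.symm z y, P.symm z x] at this
      linarith

end Placement

/-! ### Walks of outward steps within a bounding hole. -/

/-- One step outwards within a bounding hole: along an arc, or to another block. -/
def Step {Y : Type*} (T : LocalData Y) (side : Bool → Y → Prop) (out : Bool → Y → Y → Prop)
    (b : Bool) (x y : Y) : Prop :=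
  side b x ∧ side b y ∧ (T.ElemArc x y ∨ (¬ T.SameBlock x y ∧ out b x y))

namespace Placement

variable {Y : Type*} {T : LocalData Y} {side : Bool → Y → Prop} {out : Bool → Y → Y → Prop}

theorem step_of_tail (P : Placement T side out) {b : Bool} {x y : Y} (hx : side b x)
    (hy : side b y) (h : T.Tail x y) : T.Step side out b x y := by
  refine ⟨hx, hy, ?_⟩
  by_cases hb : T.SameBlock x y
  · exact .inl (.inl ⟨h, hb⟩)
  · exact .inr ⟨hb, P.out_of_tail hx hy h⟩

/-- Steps never lead inwards past an element of another block. -/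
theorem sameBlock_of_inward (P : Placement T side out) {b : Bool} {x u : Y}
    (h : Relation.ReflTransGen (T.Step side out b) x u) (hu : out b u x) :
    T.SameBlock x u ∧ ∀ w, out b u w → out b w x → T.SameBlock x w := by
  induction h with
  | refl => exact absurd hu P.out_irrefl
  | @tail u v _ hs ih =>
    obtain ⟨hsu, hsv, hs | ⟨hb, ho⟩⟩ := hs
    · have huv := P.sameBlock_of_elemArc hs
      -- Tails lead outwards, so an arc leading inwards is a strong link, and all elements between
      -- its ends are in their block.
      have key : out b v u → ∀ w, out b v w → out b w u → T.SameBlock u w := by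
        intro hvu w h1 h2
        rcases hs with hs | hs
        · exact absurd hvu (P.out_asymm b _ _ (P.out_of_tail hsu hsv hs.1))
        · rw [P.symm, max_comm] at hs
          exact .trans _ _ _ huv (P.sameBlock_of_between h1 h2 hs)
      rcases P.out_total b u x with hux | rfl | hux
      · obtain ⟨h1, h2⟩ := ih hux
        refine ⟨.trans _ _ _ h1 huv, fun w hw hw' => ?_⟩
        rcases P.out_total b u w with h3 | rfl | h3
        · exact h2 w h3 hw'
        · exact h1
        · exact .trans _ _ _ h1 (key (P.out_trans b _ _ _ hw h3) w hw h3)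
      · exact ⟨huv, key hu⟩
      · have hvu := P.out_trans b _ _ _ hu hux
        have hxu : T.SameBlock x u := .symm _ _ (key hvu x hu hux)
        exact ⟨.trans _ _ _ hxu huv, fun w hw hw' =>
          .trans _ _ _ hxu (key hvu w hw (P.out_trans b _ _ _ hw' hux))⟩
    -- Here `v` lies between `u` and `x`, hence by induction in their common block, although the
    -- step leaves the block of `u`.
    · obtain ⟨h1, h2⟩ := ih (P.out_trans b _ _ _ ho hu)
      exact absurd (.trans _ _ _ (.symm _ _ h1) (h2 v ho hu)) hb

/-- On a closed walk, a step that changes the block goes outwards and is followed by a return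
inwards to its start. This puts both its ends in one block, so only arcs occur. -/
theorem reach_elemArc_of_mutual (P : Placement T side out) {b : Bool} {x y : Y}
    (h : Relation.ReflTransGen (T.Step side out b) x y)
    (h' : Relation.ReflTransGen (T.Step side out b) y x) :
    Relation.ReflTransGen T.ElemArc x y := by
  induction h with
  | refl => exact .refl
  | @tail u v h hs ih =>
    refine (ih (.head hs h')).tail ?_
    obtain ⟨-, -, hs | ⟨hb, ho⟩⟩ := hs
    · exact hs
    · exact absurd (.symm _ _ (P.sameBlock_of_inward (h'.trans h) ho).1) hb

theorem cellOf_eq_of_mutual (P : Placement T side out) {b : Bool} {x y : Y}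
    (h : Relation.ReflTransGen (T.Step side out b) x y)
    (h' : Relation.ReflTransGen (T.Step side out b) y x) : T.cellOf x = T.cellOf y :=
  cellOf_eq_iff.mpr ⟨P.reach_elemArc_of_mutual h h', P.reach_elemArc_of_mutual h' h⟩

theorem reach_of_elemArc (P : Placement T side out) {b : Bool} {x y : Y} (hx : side b x)
    (h : Relation.ReflTransGen T.ElemArc x y) :
    Relation.ReflTransGen (T.Step side out b) x y := by
  induction h with
  | refl => exact .refl
  | @tail u v h hs ih =>
    have hu := (P.side_of_sameBlock (P.sameBlock_of_reach h)).mp hx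
    exact ih.tail ⟨hu, (P.side_of_sameBlock (P.sameBlock_of_elemArc hs)).mp hu, .inl hs⟩

theorem reach_of_cellOf_eq (P : Placement T side out) {b : Bool} {x y : Y} (hx : side b x)
    (h : T.cellOf x = T.cellOf y) : Relation.ReflTransGen (T.Step side out b) x y :=
  P.reach_of_elemArc hx (cellOf_eq_iff.mp h).1

end Placement

/-! ### Location of cells, clusters and arcs in the bounding holes. -/

/-- The cell `C` is located in the bounding hole `b`. -/
def CellSide {Y : Type*} (T : LocalData Y) (side : Bool → Y → Prop) (b : Bool) (C : T.Cell) :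
    Prop :=
  ∀ x, T.cellOf x = C → side b x

namespace Placement

variable {Y : Type*} {T : LocalData Y} {side : Bool → Y → Prop} {out : Bool → Y → Y → Prop}

theorem cellSide_of_inBlockOf (P : Placement T side out) {b : Bool} {x : Y} {C : T.Cell}
    (hx : T.InBlockOf x C) (h : side b x) : T.CellSide side b C := by
  obtain ⟨u, rfl, hu⟩ := hx
  intro y hy
  have := P.sameBlock_of_cellOf_eq hy
  exact (P.side_of_sameBlock (.trans _ _ _ this hu)).mpr h

theorem cellSide_disjoint (P : Placement T side out) {b : Bool} {C : T.Cell}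
    (h : T.CellSide side b C) : ¬ T.CellSide side (!b) C := by
  obtain ⟨x, hx⟩ := exists_cellOf_eq C
  exact fun h' => P.side_disjoint b x (h x hx) (h' x hx)

theorem cellSide_unique (P : Placement T side out) {b b' : Bool} {C : T.Cell}
    (h : T.CellSide side b C) (h' : T.CellSide side b' C) : b' = b := by
  by_contra hne
  exact P.cellSide_disjoint h (by rwa [← Bool.eq_not_of_ne hne])

theorem inBlockOf_cellOf (x : Y) : T.InBlockOf x (T.cellOf x) := ⟨x, rfl, .refl _⟩

/-- The heads `y` and `x'` lie in bounding holes. If these coincided, then `x ↣ y`, the cell of `y,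
y'`, `y' ↣ x'` and the cell of `x', x` would form a closed walk of steps and the two cells would be
equal. -/
theorem exists_side_of_s2 (P : Placement T side out) {C' C'' : T.Cell} (h : T.S2 C' C'') :
    ∃ b, T.CellSide side b C' ∧ T.CellSide side (!b) C'' := by
  obtain ⟨x, x', y, y', hx, hx', hy, hy', hxx, hyy, hne, h, h'⟩ := h
  obtain ⟨b, hb⟩ := P.side_of_tail h'
  obtain ⟨b', hb'⟩ := P.side_of_tail h
  refine ⟨b, P.cellSide_of_inBlockOf hx' hb, ?_⟩
  by_cases hbb : b' = b
  · subst hbb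
    have hx := (P.side_of_sameBlock (P.sameBlock_of_cellOf_eq hxx)).mpr hb
    have hy' := (P.side_of_sameBlock (P.sameBlock_of_cellOf_eq hyy)).mp hb'
    refine absurd (P.cellOf_eq_of_mutual (.single (P.step_of_tail hx hb' h)) ?_) hne
    exact (P.reach_of_cellOf_eq hb' hyy).trans
      (.head (P.step_of_tail hy' hb h') (P.reach_of_cellOf_eq hb hxx.symm))
  · rw [← Bool.eq_not_of_ne hbb]
    exact P.cellSide_of_inBlockOf hy hb'

theorem exists_side_of_adj (P : Placement T side out) {C' C'' : T.Cell}
    (h : T.sepGraph.Adj C' C'') : ∃ b, T.CellSide side b C' ∧ T.CellSide side (!b) C'' := by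
  have key : ∀ C' C'' : T.Cell, (T.S1 C' C'' ∨ T.S2 C' C'') →
      ∃ b, T.CellSide side b C' ∧ T.CellSide side (!b) C'' := by
    rintro C' C'' (⟨x, y, hx, hy, h⟩ | h)
    · obtain ⟨b, hb, hb'⟩ := P.side_of_sep x y h
      exact ⟨b, P.cellSide_of_inBlockOf hx hb, P.cellSide_of_inBlockOf hy hb'⟩
    · exact P.exists_side_of_s2 h
  obtain ⟨-, h | h⟩ := (SimpleGraph.fromRel_adj _ _ _).mp h
  · exact key _ _ h
  · obtain ⟨b, hb, hb'⟩ := key _ _ h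
    exact ⟨!b, hb', by simpa using hb⟩

/-- Each edge switches the bounding hole, so parity decides. The empty walk is set apart because its
cell may lie in an inner hole. -/
theorem side_of_walk (P : Placement T side out) {C' C'' : T.Cell} (w : T.sepGraph.Walk C' C'') :
    (w.length = 0 ∧ C' = C'') ∨
    ∃ b, T.CellSide side b C' ∧ (Even w.length → T.CellSide side b C'') ∧
      (Odd w.length → T.CellSide side (!b) C'') := by
  induction w with
  | nil => exact .inl ⟨rfl, rfl⟩
  | @cons u v w h q ih =>
    right
    obtain ⟨b, hb, hb'⟩ := P.exists_side_of_adj h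
    refine ⟨b, hb, ?_⟩
    rw [SimpleGraph.Walk.length_cons, Nat.even_add_one, Nat.odd_add_one, Nat.not_even_iff_odd,
      Nat.not_odd_iff_even]
    rcases ih with ⟨h0, rfl⟩ | ⟨b', h1, h2, h3⟩
    · simp [h0, hb']
    · obtain rfl := P.cellSide_unique hb' h1
      exact ⟨fun h => by simpa using h3 h, h2⟩

theorem side_of_sameCluster (P : Placement T side out) {C' C'' : T.Cell}
    (h : T.SameCluster C' C'') :
    C' = C'' ∨ ∃ b, T.CellSide side b C' ∧ T.CellSide side b C'' := by
  obtain ⟨w, hw⟩ := h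
  rcases P.side_of_walk w with ⟨-, h⟩ | ⟨b, h, h', -⟩
  · exact .inl h
  · exact .inr ⟨b, h, h' hw⟩

theorem side_of_twinClusters (P : Placement T side out) {C' C'' : T.Cell}
    (h : T.TwinClusters C' C'') : ∃ b, T.CellSide side b C' ∧ T.CellSide side (!b) C'' := by
  obtain ⟨w, hw⟩ := h
  rcases P.side_of_walk w with ⟨h, -⟩ | ⟨b, h, -, h'⟩
  · rw [h] at hw
    exact absurd hw (by decide)
  · exact ⟨b, h, h' hw⟩

theorem side_of_arc_head (P : Placement T side out) {C' C : T.Cell}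
    (h : T.G2 C' C ∨ T.G3 C' C) : ∃ b, T.CellSide side b C := by
  obtain ⟨x', x, -, hx, ht⟩ := g2_or_g3_tail h
  obtain ⟨b, hb⟩ := P.side_of_tail ht
  exact ⟨b, P.cellSide_of_inBlockOf (hx ▸ inBlockOf_cellOf x) hb⟩

theorem reach_of_arc (P : Placement T side out) {b : Bool} {C' C : T.Cell}
    (h : T.G2 C' C ∨ T.G3 C' C) (hs' : T.CellSide side b C') (hs : T.CellSide side b C)
    {x' x : Y} (hx' : T.cellOf x' = C') (hx : T.cellOf x = C) :
    Relation.ReflTransGen (T.Step side out b) x' x := by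
  obtain ⟨y', y, hy', hy, ht⟩ := g2_or_g3_tail h
  have h1 := hs' y' hy'
  have h2 := hs y hy
  exact (P.reach_of_cellOf_eq (hs' x' hx') (hx'.trans hy'.symm)).trans
    (.head (P.step_of_tail h1 h2 ht) (P.reach_of_cellOf_eq h2 (hy.trans hx.symm)))

theorem reach_of_arcs (P : Placement T side out) {b : Bool} {C' C : T.Cell}
    (h : Relation.ReflTransGen (fun C' C => (T.G2 C' C ∨ T.G3 C' C) ∧
      T.CellSide side b C' ∧ T.CellSide side b C) C' C)
    (hs : T.CellSide side b C') {x' x : Y} (hx' : T.cellOf x' = C') (hx : T.cellOf x = C) :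
    Relation.ReflTransGen (T.Step side out b) x' x := by
  induction h generalizing x with
  | refl => exact P.reach_of_cellOf_eq (hs x' hx') (hx'.trans hx.symm)
  | @tail D E _ h ih =>
    obtain ⟨y, hy⟩ := exists_cellOf_eq D
    exact (ih hy).trans (P.reach_of_arc h.1 h.2.1 h.2.2 hy hx)

/-- (G2)- and (G3)-arcs within one bounding hole do not form a cycle. -/
theorem acyclic_side (P : Placement T side out) {b : Bool} (C : T.Cell) :
    ¬ Relation.TransGen (fun C' C => (T.G2 C' C ∨ T.G3 C' C) ∧
      T.CellSide side b C' ∧ T.CellSide side b C) C C := by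
  intro h
  -- A cycle makes the elements of `C` and of its successor `D` mutually reachable by steps, so `C =
  -- D`, while arcs join distinct cells.
  obtain ⟨D, h, h'⟩ := Relation.TransGen.head'_iff.mp h
  obtain ⟨x, hx⟩ := exists_cellOf_eq C
  obtain ⟨y, hy⟩ := exists_cellOf_eq D
  have h1 := P.reach_of_arc h.1 h.2.1 h.2.2 hx hy
  have h2 := P.reach_of_arcs h' h.2.2 hy hx
  have h3 := P.cellOf_eq_of_mutual h1 h2
  rw [hx, hy] at h3
  rcases h.1 with h | h
  · exact h.1 h3
  · exact h.1 h3

theorem adj_of_sep {C' C'' : T.Cell} {x y : Y} (hx : T.InBlockOf x C') (hy : T.InBlockOf y C'')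
    (h : T.Sep x y) (hne : C' ≠ C'') : T.sepGraph.Adj C' C'' :=
  (SimpleGraph.fromRel_adj _ _ _).mpr ⟨hne, .inl (.inl ⟨x, y, hx, hy, h⟩)⟩

theorem twin_of_sep {C' C'' : T.Cell} {x y : Y} (hx : T.InBlockOf x C') (hy : T.InBlockOf y C'')
    (h : T.Sep x y) (hne : C' ≠ C'') : T.TwinClusters C' C'' :=
  ⟨(adj_of_sep hx hy h hne).toWalk, by simp⟩

theorem ne_of_sep (P : Placement T side out) {C' C'' : T.Cell} {x y : Y} (hx : T.InBlockOf x C')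
    (hy : T.InBlockOf y C'') (h : T.Sep x y) : C' ≠ C'' := by
  rintro rfl
  obtain ⟨b, hb, hb'⟩ := P.side_of_sep x y h
  exact P.cellSide_disjoint (P.cellSide_of_inBlockOf hx hb) (P.cellSide_of_inBlockOf hy hb')

/-- Only the first arc of a sequence of (G3)-arcs can lead to the other bounding hole. -/
theorem cellSide_of_g3_g3 (P : Placement T side out) {b : Bool} {C'' C' C : T.Cell}
    (h : T.G3 C'' C') (h' : T.G3 C' C) (hs : T.CellSide side b C') : T.CellSide side b C := by
  have hε := P.eps_nonneg
  obtain ⟨q, p, w, hq, hp, hw⟩ := g3_witness h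
  obtain ⟨x', x, z, hx', hx, hz⟩ := g3_witness h'
  have hpq := mean_le_of_not_g2 h.1 h.2.1 h.2.2.1 h.2.2.2.1 hp hq
  have hxx := mean_le_of_not_g2 h'.1 h'.2.1 h'.2.2.1 h'.2.2.2.1 hx hx'
  have hxp := mean_le_of_not_g2 h'.1 h'.2.1 h'.2.2.1 h'.2.2.2.1 hx hp
  have w1 := le_max_left (T.mean q) (T.mean w)
  have w2 := le_max_right (T.mean q) (T.mean w)
  have z1 := le_max_left (T.mean x') (T.mean z)
  have z2 := le_max_right (T.mean x') (T.mean z)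
  have sep_of {u v : Y} (h1 : T.mean u + 3 * T.ε < T.dist u v)
      (h2 : T.mean v + 3 * T.ε < T.dist u v) : T.Sep u v := by
    unfold Sep
    rw [max_add]
    exact max_lt h1 h2
  have hpw : T.Sep p w := sep_of (by linarith) (by linarith)
  have hxz : T.Sep x z := sep_of (by linarith) (by linarith)
  have hpC : T.InBlockOf p C' := hp ▸ inBlockOf_cellOf p
  have hxC : T.InBlockOf x C := hx ▸ inBlockOf_cellOf x
  have hxC' : T.InBlockOf x' C' := hx' ▸ inBlockOf_cellOf x'
  have notwin : ¬ T.TwinClusters C' C := fun ht => h'.2.1 ⟨h'.1, ht⟩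
  have nosep : ∀ u v, T.InBlockOf u C' → T.InBlockOf v C → ¬ T.Sep u v := fun u v hu hv hs =>
    notwin (twin_of_sep hu hv hs h'.1)
  obtain ⟨b', hb', hbz⟩ := P.side_of_sep x z hxz
  by_cases hbb : b' = b
  · subst hbb
    exact P.cellSide_of_inBlockOf hxC hb'
  -- Suppose that `x` is in the hole opposite to `C'`. Then `z` is on the side of `C'` and `w` on
  -- the side of `x`. The contradiction will be a separated pair between the blocks of `C'` and `C`,
  -- or an odd walk joining these cells.
  exfalso
  obtain rfl := Bool.eq_not_of_ne hbb
  rw [Bool.not_not] at hbz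
  have hsx := hs x' hx'
  have hsp := hs p hp
  have hbw : side (!b) w := by
    obtain ⟨b', h1, h2⟩ := P.side_of_sep p w hpw
    have : b' = b := P.cellSide_unique hs (P.cellSide_of_inBlockOf hpC h1)
    rwa [this] at h2
  have hzC : ¬ T.SameBlock x' z := fun hb =>
    nosep z x ⟨x', hx', hb⟩ hxC (hxz.symm_of P.symm)
  have hpx := P.sameBlock_of_cellOf_eq (hp.trans hx'.symm)
  have hxz' : out b x' z := by
    rcases P.out_total b x' z with ho | rfl | ho
    · exact ho
    · exact absurd (.refl _) hzC
    · have := P.cross b x z x' hb' hbz hsx ho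
      rw [P.symm x x'] at this
      exact absurd (sep_of (by linarith) (by linarith)) (nosep x' x hxC' hxC)
  -- If `p` were beyond `z`, then `z` would lie between the members `x'` and `p` of one cell, hence
  -- in their block.
  have hpz : out b p z := by
    rcases P.out_total b p z with ho | rfl | ho
    · exact ho
    · exact absurd (.symm _ _ hpx) hzC
    · have := (P.sameBlock_of_inward (P.reach_of_cellOf_eq hsp (hp.trans hx'.symm))
        (P.out_trans b _ _ _ hxz' ho)).2 z hxz' ho
      exact absurd (.trans _ _ _ (.symm _ _ hpx) this) hzC
  -- This uses all of the constant `16`: `3 ε` for the missing link, `2 ε` for moving from `w` to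
  -- `x`, `4 ε` for each of the two comparisons of means along `C''`, `C'`, `C`, and `3 ε` for
  -- separation.
  have key : out (!b) w x ∨ w = x → False := by
    intro ho
    have : T.dist p w ≤ T.dist p x + 2 * T.ε := by
      rcases ho with ho | rfl
      · exact P.cross (!b) p w x (by simpa using hsp) hbw hb' ho
      · linarith
    exact nosep p x hpC hxC (sep_of (by linarith) (by linarith))
  -- When `w` is beyond `x`, the elements `w` and `z` are the outer ones on their sides. So they are
  -- separated too, and `p, w, z, x` yields a walk of length three from `C'` to `C`.
  rcases P.out_total (!b) x w with ho | rfl | ho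
  · have h1 := P.cross (!b) z x w (by simpa using hbz) hb' hbw ho
    have h2 := P.cross b w p z hbw hsp hbz hpz
    rw [P.symm z x, P.symm z w] at h1
    rw [P.symm w p] at h2
    have hwz : T.Sep w z := sep_of (by linarith) (by linarith)
    have i1 := inBlockOf_cellOf (T := T) w
    have i2 := inBlockOf_cellOf (T := T) z
    exact notwin ⟨.cons (adj_of_sep hpC i1 hpw (P.ne_of_sep hpC i1 hpw))
      (.cons (adj_of_sep i1 i2 hwz (P.ne_of_sep i1 i2 hwz))
        (adj_of_sep i2 hxC (hxz.symm_of P.symm) (P.ne_of_sep hxC i2 hxz).symm).toWalk), by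
          simp [SimpleGraph.Adj.toWalk]; decide⟩
  · exact key (.inr rfl)
  · exact key (.inl ho)

end Placement

end LocalData

end SeriationFit

/-! ### Cycles of the cell graph in the presence of a compatible order. -/

namespace SeriationFit

theorem transGen_of_seq {α : Type*} {r : α → α → Prop} {g : ℕ → α} {n : ℕ} (hn : 0 < n)
    (h : ∀ k < n, r (g k) (g (k + 1))) : Relation.TransGen r (g 0) (g n) := by
  induction n with
  | zero => exact absurd hn (lt_irrefl 0)
  | succ n ih =>
    rcases Nat.eq_zero_or_pos n with rfl | hn'
    · exact .single (h 0 hn)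
    · exact (ih hn' fun k hk => h k (hk.trans n.lt_succ_self)).tail (h n n.lt_succ_self)

namespace LocalData

theorem Arc.ne {Y : Type*} {T : LocalData Y} {C' C : T.Cell} (h : T.Arc C' C) : C' ≠ C := by
  rcases h with h | h | h <;> exact h.1

namespace Placement

variable {Y : Type*} {T : LocalData Y} {side : Bool → Y → Prop} {out : Bool → Y → Y → Prop}

theorem noG3Cycle (P : Placement T side out) : T.NoG3Cycle := by
  intro C h
  obtain ⟨D, -, hD⟩ := Relation.TransGen.tail'_iff.mp h
  obtain ⟨b, hb⟩ := P.side_of_arc_head (.inr hD)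
  have key : ∀ E, Relation.TransGen T.G3 C E → Relation.TransGen (fun C' C =>
      (T.G2 C' C ∨ T.G3 C' C) ∧ T.CellSide side b C' ∧ T.CellSide side b C) C E ∧
      T.CellSide side b E ∧ ∃ F, T.G3 F E := by
    intro E hE
    induction hE with
    | single h =>
      have := P.cellSide_of_g3_g3 hD h hb
      exact ⟨.single ⟨.inr h, hb, this⟩, this, _, h⟩
    | tail _ h ih =>
      obtain ⟨h1, h2, F, hF⟩ := ih
      have := P.cellSide_of_g3_g3 hF h h2
      exact ⟨h1.tail ⟨.inr h, h2, this⟩, this, _, h⟩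
  exact P.acyclic_side C (key C h).1

/-- A cluster either lies in a single bounding hole, where (G1)-arcs are impossible and the others
are acyclic, or consists of a single cell. -/
theorem acyclicOn_cluster (P : Placement T side out) {K : Set T.Cell} (hK : T.IsCluster K) :
    T.AcyclicOn K := by
  obtain ⟨C₀, rfl⟩ := hK
  intro C h
  by_cases hs : ∃ b, T.CellSide side b C₀
  · obtain ⟨b, hb⟩ := hs
    have hall : ∀ D, T.SameCluster C₀ D → T.CellSide side b D := by
      intro D hD
      rcases P.side_of_sameCluster hD with rfl | ⟨b', h1, h2⟩
      · exact hb
      · rwa [← P.cellSide_unique hb h1]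
    refine P.acyclic_side (b := b) C (Relation.TransGen.mono ?_ _ _ h)
    rintro D E ⟨hD, hE, h | h⟩
    · obtain ⟨b', h1, h2⟩ := P.side_of_twinClusters h.2
      obtain rfl := P.cellSide_unique (hall D hD) h1
      exact absurd h2 (P.cellSide_disjoint (hall E hE))
    · exact ⟨h, hall D hD, hall E hE⟩
  · have hall : ∀ D, T.SameCluster C₀ D → C₀ = D := by
      intro D hD
      rcases P.side_of_sameCluster hD with h | ⟨b', h1, -⟩
      · exact h
      · exact absurd ⟨b', h1⟩ hs
    obtain ⟨D, ⟨hC, hD, h⟩, -⟩ := Relation.TransGen.head'_iff.mp h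
    exact h.ne ((hall _ hC).symm.trans (hall _ hD))

theorem side_of_g3_path (P : Placement T side out) {g : ℕ → T.Cell} {m n : ℕ} (hmn : m < n)
    (h : ∀ k, m ≤ k → k < n → T.G3 (g k) (g (k + 1))) :
    ∃ b, ∀ k, m < k → k ≤ n → T.CellSide side b (g k) := by
  obtain ⟨b, hb⟩ := P.side_of_arc_head (.inr (h m le_rfl hmn))
  refine ⟨b, fun k hk => ?_⟩
  induction k, hk using Nat.le_induction with
  | base => exact fun _ => hb
  | succ k hk ih =>
    intro hkn
    obtain ⟨l, rfl⟩ : ∃ l, k = l + 1 := ⟨k - 1, by omega⟩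
    exact P.cellSide_of_g3_g3 (h l (by omega) (by omega)) (h (l + 1) (by omega) (by omega))
      (ih (by omega))

theorem acyclic_seq (P : Placement T side out) {g : ℕ → T.Cell} {n : ℕ} {b : Bool} (hn : 0 < n)
    (hg : g n = g 0) (h : ∀ k < n, T.G2 (g k) (g (k + 1)) ∨ T.G3 (g k) (g (k + 1)))
    (hs : ∀ k ≤ n, T.CellSide side b (g k)) : False := by
  have := transGen_of_seq (g := g) (r := fun C' C => (T.G2 C' C ∨ T.G3 C' C) ∧
    T.CellSide side b C' ∧ T.CellSide side b C) hn
      fun k hk => ⟨h k hk, hs k hk.le, hs (k + 1) hk⟩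
  rw [hg] at this
  exact P.acyclic_side _ this

theorem opposite_of_ne {b b' : Bool} {C C' : T.Cell} (h : T.CellSide side b C)
    (h' : T.CellSide side b' C') (hne : b' ≠ b) :
    ∃ b, T.CellSide side b C ∧ T.CellSide side (!b) C' :=
  ⟨b, h, by rwa [← Bool.eq_not_of_ne hne]⟩

/-- All heads of (G3)-arcs, among them `g 0`, share one bounding hole. With `g 1` in it as well, the
whole cycle would lie there. -/
theorem opposite_of_oneCycle (P : Placement T side out) {g : ℕ → T.Cell} {n : ℕ} (hn : 2 ≤ n)
    (hg : g n = g 0) (h0 : T.G2 (g 0) (g 1))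
    (h : ∀ k, 1 ≤ k → k < n → T.G3 (g k) (g (k + 1))) :
    ∃ b, T.CellSide side b (g 0) ∧ T.CellSide side (!b) (g 1) := by
  obtain ⟨b, hb⟩ := P.side_of_g3_path (show 1 < n by omega) h
  obtain ⟨b', hb'⟩ := P.side_of_arc_head (.inl h0)
  have hg0 := hb n hn le_rfl
  rw [hg] at hg0
  refine opposite_of_ne hg0 hb' ?_
  rintro rfl
  refine P.acyclic_seq (b := b') (by omega) hg (fun k hk => ?_) (fun k hk => ?_)
  · rcases Nat.eq_zero_or_pos k with rfl | hk'
    · exact .inl h0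
    · exact .inr (h k hk' hk)
  · rcases (by omega : k = 0 ∨ k = 1 ∨ 1 < k) with rfl | rfl | hk'
    · exact hg0
    · exact hb'
    · exact hb k hk' hk

/-- In a 2-cycle the first three cells are not all in one bounding hole. -/
theorem side_of_twoCycle (P : Placement T side out) {g : ℕ → T.Cell} {n : ℕ} (hn : 3 ≤ n)
    (hg : g n = g 0) (h0 : T.G2 (g 0) (g 1)) (h1 : T.G2 (g 1) (g 2))
    (h : ∀ k, 2 ≤ k → k < n → T.G3 (g k) (g (k + 1))) :
    ∃ b b₁ b₂, (∀ k, 2 < k → k ≤ n → T.CellSide side b (g k)) ∧ T.CellSide side b (g 0) ∧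
      T.CellSide side b₁ (g 1) ∧ T.CellSide side b₂ (g 2) ∧ (b₁ ≠ b ∨ b₂ ≠ b) := by
  obtain ⟨b, hb⟩ := P.side_of_g3_path (show 2 < n by omega) h
  obtain ⟨b₁, hb₁⟩ := P.side_of_arc_head (.inl h0)
  obtain ⟨b₂, hb₂⟩ := P.side_of_arc_head (.inl h1)
  have hg0 := hb n hn le_rfl
  rw [hg] at hg0
  refine ⟨b, b₁, b₂, hb, hg0, hb₁, hb₂, ?_⟩
  by_contra! hc
  obtain ⟨rfl, rfl⟩ := hc
  refine P.acyclic_seq (b := b₂) (by omega) hg (fun k hk => ?_) (fun k hk => ?_)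
  · rcases (by omega : k = 0 ∨ k = 1 ∨ 2 ≤ k) with rfl | rfl | hk'
    · exact .inl h0
    · exact .inl h1
    · exact .inr (h k hk' hk)
  · rcases (by omega : k = 0 ∨ k = 1 ∨ k = 2 ∨ 2 < k) with rfl | rfl | rfl | hk'
    · exact hg0
    · exact hb₁
    · exact hb₂
    · exact hb k hk' hk

/-- The cells that can be reached from the head of a (G3)-arc within a bounding hole, and whose
means do not exceed those of its tail, are all adjacent to one and the same cell. -/
theorem exists_adj_of_path (P : Placement T side out) {b : Bool} {C' C : T.Cell}
    (h : T.G3 C' C) (hs : T.CellSide side b C) :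
    ∃ Z : T.Cell, ∀ D, D ≠ C' → ¬ T.G1 C' D → ¬ T.G2 C' D → T.CellSide side b D →
      Relation.ReflTransGen (fun C' C => (T.G2 C' C ∨ T.G3 C' C) ∧
        T.CellSide side b C' ∧ T.CellSide side b C) C D → T.sepGraph.Adj D Z := by
  have hε := P.eps_nonneg
  obtain ⟨x', x, z, hx', hx, hz⟩ := g3_witness h
  have hxx := mean_le_of_not_g2 h.1 h.2.1 h.2.2.1 h.2.2.2.1 hx hx'
  have z1 := le_max_left (T.mean x') (T.mean z)
  have z2 := le_max_right (T.mean x') (T.mean z)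
  have sep_of {u v : Y} (h1 : T.mean u + 3 * T.ε < T.dist u v)
      (h2 : T.mean v + 3 * T.ε < T.dist u v) : T.Sep u v := by
    unfold Sep
    rw [max_add]
    exact max_lt h1 h2
  have hxz : T.Sep x z := sep_of (by linarith) (by linarith)
  have hsx := hs x hx
  have hsz : side (!b) z := by
    obtain ⟨b', h1, h2⟩ := P.side_of_sep x z hxz
    have : b' = b := P.cellSide_unique hs
      (P.cellSide_of_inBlockOf (hx ▸ inBlockOf_cellOf x) h1)
    rwa [this] at h2
  have hzZ := inBlockOf_cellOf (T := T) z
  refine ⟨T.cellOf z, fun D hne h1 h2 hD hr => ?_⟩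
  obtain ⟨v, hv⟩ := exists_cellOf_eq D
  have hsv := hD v hv
  have hm := mean_le_of_not_g2 hne.symm h1 (fun h => h1 (g1_symm h)) h2 hv hx'
  have hreach := P.reach_of_arcs hr hs hx hv
  -- If `v` is at or beyond `x`, then `v` is itself separated from `z`. If `v` is further in, then
  -- `x` belongs to the block of `D` and (S1) applies to `x` and `z`.
  rcases P.out_total b x v with ho | rfl | ho
  · have := P.cross b z x v hsz hsx hsv ho
    rw [P.symm z x, P.symm z v] at this
    have hvz : T.Sep v z := sep_of (by linarith) (by linarith)
    have hvD : T.InBlockOf v D := hv ▸ inBlockOf_cellOf v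
    exact adj_of_sep hvD hzZ hvz (P.ne_of_sep hvD hzZ hvz)
  · have hvD : T.InBlockOf x D := hv ▸ inBlockOf_cellOf x
    exact adj_of_sep hvD hzZ hxz (P.ne_of_sep hvD hzZ hxz)
  · have hxD : T.InBlockOf x D := ⟨v, hv, .symm _ _ (P.sameBlock_of_inward hreach ho).1⟩
    exact adj_of_sep hxD hzZ hxz (P.ne_of_sep hxD hzZ hxz)

/-- If `g 0` and `g 1` shared a bounding hole, then `g 2` would be opposite, and everything from `g
3` on, including `g (n + 1) = g 1`, could be reached from `g 3` within that hole. A common neighbour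
in the separation graph then puts `g t` and `g 1` in one cluster. -/
theorem opposite_of_twoCycle_first (P : Placement T side out) {g : ℕ → T.Cell} {n : ℕ}
    (hn : 3 ≤ n) (hg : g n = g 0) (hg' : g (n + 1) = g 1) (h0 : T.G2 (g 0) (g 1))
    (h1 : T.G2 (g 1) (g 2)) (h : ∀ k, 2 ≤ k → k < n → T.G3 (g k) (g (k + 1)))
    (hind : ∀ k, 2 < k → k ≤ n + 1 → g k ≠ g 2 ∧ ¬ T.G1 (g 2) (g k) ∧ ¬ T.G2 (g 2) (g k))
    {t : ℕ} (ht : 2 < t) (htn : t ≤ n) (hc : ¬ T.SameCluster (g t) (g 1)) :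
    ∃ b, T.CellSide side b (g 0) ∧ T.CellSide side (!b) (g 1) := by
  obtain ⟨b, b₁, b₂, hb, hb₀, hb₁, hb₂, hne⟩ := P.side_of_twoCycle hn hg h0 h1 h
  refine opposite_of_ne hb₀ hb₁ ?_
  rintro rfl
  obtain rfl := Bool.eq_not_of_ne (hne.resolve_left (fun h => h rfl))
  obtain ⟨Z, hZ⟩ := P.exists_adj_of_path (h 2 le_rfl hn) (hb 3 (by omega) hn)
  have hbs : ∀ k, 2 < k → k ≤ n + 1 → T.CellSide side b₁ (g k) := by
    intro k hk hkn
    rcases hkn.lt_or_eq with hkn | rfl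
    · exact hb k hk (by omega)
    · rwa [hg']
  have harc : ∀ k, 2 < k → k ≤ n → T.G2 (g k) (g (k + 1)) ∨ T.G3 (g k) (g (k + 1)) := by
    intro k hk hkn
    rcases hkn.lt_or_eq with hkn | rfl
    · exact .inr (h k (by omega) hkn)
    · rw [hg, hg']
      exact .inl h0
  have hadj : ∀ k, 2 < k → k ≤ n + 1 → T.sepGraph.Adj (g k) Z := by
    intro k hk hkn
    refine hZ _ (hind k hk hkn).1 (hind k hk hkn).2.1 (hind k hk hkn).2.2 (hbs k hk hkn) ?_
    clear hc
    induction k, hk using Nat.le_induction with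
    | base => exact .refl
    | succ k hk ih =>
      exact (ih (by omega)).tail ⟨harc k hk (by omega), hbs k hk (by omega), hbs _ (by omega) hkn⟩
  refine hc ⟨.cons (hadj t ht (by omega)) (hg' ▸ hadj (n + 1) (by omega) le_rfl).symm.toWalk, ?_⟩
  simp [SimpleGraph.Adj.toWalk]

/-- The shared cluster forces `g 1` into the bounding hole of the heads of (G3)-arcs, so that `g 2`
must be the cell in the other one. -/
theorem opposite_of_twoCycle_second (P : Placement T side out) {g : ℕ → T.Cell} {n : ℕ}
    (hn : 3 ≤ n) (hg : g n = g 0) (h0 : T.G2 (g 0) (g 1))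
    (h1 : T.G2 (g 1) (g 2)) (h : ∀ k, 2 ≤ k → k < n → T.G3 (g k) (g (k + 1)))
    {t : ℕ} (ht : 2 < t) (htn : t ≤ n) (hc : T.SameCluster (g t) (g 1)) (hne : g t ≠ g 1) :
    ∃ b, T.CellSide side b (g 1) ∧ T.CellSide side (!b) (g 2) := by
  obtain ⟨b, b₁, b₂, hb, hb₀, hb₁, hb₂, hne'⟩ := P.side_of_twoCycle hn hg h0 h1 h
  refine opposite_of_ne hb₁ hb₂ ?_
  rintro rfl
  obtain ⟨b', h1, h2⟩ := (P.side_of_sameCluster hc).resolve_left hne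
  have e1 := P.cellSide_unique (hb t ht htn) h1
  have e2 := P.cellSide_unique hb₁ h2
  subst e1 e2
  simp at hne'

end Placement

end LocalData

end SeriationFit

namespace SeriationFit

/-! ## Shortest cycles -/

theorem exists_seq_of_transGen {α : Type*} {r : α → α → Prop} {x y : α}
    (h : Relation.TransGen r x y) :
    ∃ (n : ℕ) (g : ℕ → α), 0 < n ∧ g 0 = x ∧ g n = y ∧ ∀ k < n, r (g k) (g (k + 1)) := by
  induction h with
  | @single y h =>
    refine ⟨1, fun k => if k = 0 then x else y, one_pos, by simp, by simp, fun k hk => ?_⟩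
    obtain rfl : k = 0 := by omega
    simpa using h
  | @tail y z _ h ih =>
    obtain ⟨n, g, hn, h0, h1, hg⟩ := ih
    refine ⟨n + 1, fun k => if k ≤ n then g k else z, by omega, by simpa using h0, by simp, ?_⟩
    intro k hk
    rcases (Nat.lt_succ_iff.mp hk).lt_or_eq with hk | rfl
    · simpa [hk.le, Nat.succ_le_of_lt hk] using hg k hk
    · simpa [h1] using h

theorem exists_closed_of_seq {α : Type*} {r : α → α → Prop} {n : ℕ} {g : ℕ → α} (hn : 0 < n)
    (h0 : g n = g 0) (hg : ∀ k < n, r (g k) (g (k + 1))) :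
    ∃ c : ZMod n → α, ∀ s, r (c s) (c (s + 1)) := by
  have : NeZero n := ⟨hn.ne'⟩
  refine ⟨fun s => g s.val, fun s => ?_⟩
  have : g (s + 1).val = g (s.val + 1) := by
    rcases (Nat.succ_le_of_lt (ZMod.val_lt s)).lt_or_eq with h | h
    · rw [show s + 1 = ((s.val + 1 : ℕ) : ZMod n) by simp, ZMod.val_natCast_of_lt (by omega)]
    · have h' : s + 1 = 0 := by
        have := congrArg (Nat.cast : ℕ → ZMod n) h
        simpa using this
      rw [h', ZMod.val_zero, ← h0]
      exact congrArg g h.symm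
  show r (g s.val) (g (s + 1).val)
  rw [this]
  exact hg _ (ZMod.val_lt s)

/-- A directed graph without loops that has a directed cycle has an induced one. -/
theorem exists_induced_cycle {α : Type*} {r : α → α → Prop} (hirr : ∀ x, ¬ r x x) {x : α}
    (h : Relation.TransGen r x x) :
    ∃ (n : ℕ) (c : ZMod n → α), 2 ≤ n ∧ Function.Injective c ∧
      ∀ s t, r (c s) (c t) ↔ t = s + 1 := by
  classical
  have hex : ∃ n, 0 < n ∧ ∃ c : ZMod n → α, ∀ s, r (c s) (c (s + 1)) := by
    obtain ⟨n, g, hn, h0, h1, hg⟩ := exists_seq_of_transGen h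
    exact ⟨n, hn, exists_closed_of_seq hn (h1.trans h0.symm) hg⟩
  obtain ⟨hn, c, hc⟩ := Nat.find_spec hex
  have hmin := fun m (hm : m < Nat.find hex) => Nat.find_min hex hm
  generalize Nat.find hex = n at hn c hc hmin
  have : NeZero n := ⟨hn.ne'⟩
  have chord : ∀ s t, r (c s) (c t) → t = s + 1 := by
    intro s t hst
    have hlt := ZMod.val_lt (s - t)
    have hs : t + ((s - t).val : ZMod n) = s := by simp
    -- Following the cycle from `t` to `s` and returning by the arc `c s ↣ c t` gives a closed walk
    -- of length `(s - t).val + 1`. Minimality of `n` leaves only `t = s + 1`.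
    have hle : n ≤ (s - t).val + 1 := by
      by_contra hlt'
      refine hmin _ (not_le.mp hlt') ⟨Nat.succ_pos _, exists_closed_of_seq
        (g := fun k => if k ≤ (s - t).val then c (t + k) else c t) (Nat.succ_pos _) (by simp) ?_⟩
      intro k hk
      rcases (Nat.lt_succ_iff.mp hk).lt_or_eq with hk' | hk'
      · have h1 : k + 1 ≤ (s - t).val := hk'
        simp only [hk'.le, h1, if_true]
        have := hc (t + k)
        rwa [add_assoc, ← Nat.cast_succ] at this
      · subst hk'
        simp only [le_refl, if_true]
        rw [if_neg (by omega), hs]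
        exact hst
    have h1 : (((s - t).val + 1 : ℕ) : ZMod n) = 0 := by
      rw [show (s - t).val + 1 = n by omega, ZMod.natCast_self]
    rw [Nat.cast_succ, ZMod.natCast_zmod_val] at h1
    linear_combination -h1
  refine ⟨n, c, ?_, ?_, fun s t => ⟨chord s t, fun h => h ▸ hc s⟩⟩
  · by_contra hn2
    obtain rfl : n = 1 := by omega
    have := hc 0
    rw [Subsingleton.elim (0 + 1 : ZMod 1) 0] at this
    exact hirr _ this
  · intro s t hst
    have := chord s (t + 1) (hst ▸ hc t)
    exact (add_right_cancel this).symm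

theorem transGen_of_cycle {α : Type*} {r : α → α → Prop} {n : ℕ} (hn : 0 < n) {c : ZMod n → α}
    (h : ∀ s, r (c s) (c (s + 1))) : Relation.TransGen r (c 0) (c 0) := by
  have := transGen_of_seq (g := fun k : ℕ => c k) (r := r) hn fun k _ => by
    simpa using h k
  simpa using this

theorem zmod_add_natCast_inj {n : ℕ} {s : ZMod n} {k l : ℕ} (hkl : k ≤ l) (hln : l < k + n)
    (h : s + l = s + k) : l = k := by
  have h1 := (ZMod.natCast_eq_natCast_iff k l n).mp (add_left_cancel h).symm
  have h2 := (Nat.modEq_iff_dvd' hkl).mp h1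
  by_contra hne
  have := Nat.le_of_dvd (by omega) h2
  omega

namespace LocalData

variable {Y : Type*} {T : LocalData Y}

/-! ## Satisfying assignments define acyclic partitions -/

theorem ne_of_neClauses {V : Type*} {A : V → Bool} {u v : V}
    (h : ∀ κ ∈ neClauses u v, A κ.1.1 = κ.1.2 ∨ A κ.2.1 = κ.2.2) : A u ≠ A v := by
  have h1 := h ((u, true), (v, true)) (by simp [neClauses])
  have h2 := h ((u, false), (v, false)) (by simp [neClauses])
  simp only at h1 h2
  intro he
  rw [he] at h1 h2
  cases hv : A v <;> simp [hv] at h1 h2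

theorem ne_of_twinClusters {A : T.Cell → Bool} (hA : Satisfies A T.formula) {C C' : T.Cell}
    (h : T.TwinClusters C C') : A C ≠ A C' :=
  ne_of_neClauses fun κ hκ => hA κ (.inr (.inl ⟨C, C', h, hκ⟩))

theorem ne_of_omega12 {A : T.Cell → Bool} (hA : Satisfies A T.formula) {C C₀ : T.Cell}
    (h : C₀ ∈ T.Omega1 C ∪ T.Omega2 C) : A C ≠ A C₀ :=
  ne_of_neClauses fun κ hκ => hA κ (.inr (.inr (.inl ⟨C, C₀, h, hκ⟩)))

theorem ne_of_omega3 {A : T.Cell → Bool} (hA : Satisfies A T.formula) {C C₀ : T.Cell}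
    (h : C₀ ∈ T.Omega3 C) : A C ≠ A C₀ :=
  ne_of_neClauses fun κ hκ => hA κ (.inr (.inr (.inr ⟨C, C₀, h, hκ⟩)))

/-- Opposite inequalities between means are tails in both directions, which is (S2). The cells would
then be twins, which excludes (G2). -/
theorem G2.asymm {C' C : T.Cell} (h : T.G2 C' C) : ¬ T.G2 C C' := by
  rintro ⟨-, -, -, y', y, hy', hy, hm'⟩
  obtain ⟨hne, h1, -, x, x', hx, hx', hm⟩ := h
  have hadj : T.sepGraph.Adj C' C := by
    refine (SimpleGraph.fromRel_adj _ _ _).mpr ⟨hne, .inl (.inr ⟨x', y', x, y,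
      ⟨x', hx', .refl _⟩, ⟨y', hy', .refl _⟩, ⟨x, hx, .refl _⟩, ⟨y, hy, .refl _⟩,
      hx'.trans hy'.symm, hx.trans hy.symm, ?_, .inl hm, .inl hm'⟩)⟩
    rw [hx, hx']
    exact hne
  exact h1 ⟨hne, hadj.toWalk, by simp⟩

theorem sameCluster_refl (C : T.Cell) : T.SameCluster C C := ⟨.nil, by simp⟩

theorem sameCluster_trans {C C' C'' : T.Cell} (h : T.SameCluster C C')
    (h' : T.SameCluster C' C'') : T.SameCluster C C'' := by
  obtain ⟨w, hw⟩ := h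
  obtain ⟨w', hw'⟩ := h'
  exact ⟨w.append w', by rw [SimpleGraph.Walk.length_append]; exact hw.add hw'⟩

theorem isCluster_sameCluster (C : T.Cell) : T.IsCluster {C' | T.SameCluster C C'} := ⟨C, rfl⟩

/-- In an induced cycle without (G1)-arcs any two (G2)-arcs are consecutive. -/
theorem consecutive_of_g2 {n : ℕ} {c : ZMod n → T.Cell} (hc : T.IsInducedCycle c)
    (hG1 : ∀ s t, ¬ T.G1 (c s) (c t)) {s t : ZMod n} (hst : s ≠ t)
    (hs : T.G2 (c s) (c (s + 1))) (ht : T.G2 (c t) (c (t + 1))) : t = s + 1 ∨ s = t + 1 := by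
  by_contra! hne
  obtain ⟨-, -, -, x, x', hx, hx', hm⟩ := hs
  obtain ⟨-, -, -, y, y', hy, hy', hm'⟩ := ht
  have noarc : ∀ u v, v ≠ u + 1 → ¬ T.G2 (c u) (c v) := fun u v huv h =>
    huv ((hc.2.2 u v).mp (.inr (.inl h)))
  -- The two (G2)-arcs raise the sum of two means by more than `8 ε`; the missing crossed chords `s`
  -- to `t + 1` and `t` to `s + 1` allow at most `8 ε`.
  have h1 := mean_le_of_not_g2 (hc.2.1.ne hne.2) (hG1 _ _) (hG1 _ _)
    (noarc s (t + 1) fun h => hst (add_right_cancel h).symm) hy hx'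
  have h2 := mean_le_of_not_g2 (hc.2.1.ne hne.1) (hG1 _ _) (hG1 _ _)
    (noarc t (s + 1) fun h => hst (add_right_cancel h)) hx hy'
  linarith

theorem zmod_two_ne_zero {n : ℕ} (hn : 3 ≤ n) : (2 : ZMod n) ≠ 0 := by
  intro h
  have := zmod_add_natCast_inj (n := n) (s := 0) (k := 0) (l := 2) (by omega) (by omega)
    (by simpa using h)
  omega

/-- If an assignment satisfies the formula, then there is no induced cycle on cells with the same
value. -/
theorem no_induced_cycle (hG3 : T.NoG3Cycle) (hK : ∀ K, T.IsCluster K → T.AcyclicOn K)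
    {A : T.Cell → Bool} (hA : Satisfies A T.formula) {n : ℕ} {c : ZMod n → T.Cell}
    (hc : T.IsInducedCycle c) (hconst : ∀ s t, A (c s) = A (c t)) : False := by
  have hn := hc.1
  have harc : ∀ s, T.Arc (c s) (c (s + 1)) := fun s => (hc.2.2 s (s + 1)).mpr rfl
  have hG1 : ∀ s t, ¬ T.G1 (c s) (c t) := fun s t h => ne_of_twinClusters hA h.2 (hconst s t)
  have h23 : ∀ s, ¬ T.G2 (c s) (c (s + 1)) → T.G3 (c s) (c (s + 1)) := fun s h2 =>
    ((harc s).resolve_left (hG1 _ _)).resolve_left h2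
  by_cases h0 : ∃ s₀, T.G2 (c s₀) (c (s₀ + 1))
  swap
  · push Not at h0
    exact hG3 _ (transGen_of_cycle (by omega) fun s => h23 s (h0 s))
  obtain ⟨s₀, hs₀⟩ := h0
  by_cases h1 : ∃ s, s ≠ s₀ ∧ T.G2 (c s) (c (s + 1))
  swap
  · push Not at h1
    have hone : T.IsOneCycle c := ⟨hc, s₀, hs₀, fun s hs => h23 s (h1 s hs)⟩
    have hhead : ∀ s, T.G3 (c s) (c (s + 1)) → T.SameCluster (c (s + 1)) (c (s₀ + 1)) := by
      intro s hs
      by_contra hcl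
      exact ne_of_omega12 hA (.inl ⟨n, c, _, s₀, hone, isCluster_sameCluster (c (s + 1)), hcl,
        ⟨s, hs, sameCluster_refl _⟩, rfl, rfl, hs₀⟩) (hconst (s₀ + 1) s₀)
    have hall : ∀ s, T.SameCluster (c (s₀ + 1)) (c s) := by
      intro s
      obtain ⟨u, rfl⟩ : ∃ u, s = u + 1 := ⟨s - 1, by ring⟩
      by_cases hu : u = s₀
      · subst hu
        exact sameCluster_refl _
      · exact sameCluster_symm (hhead u (h23 u (h1 u hu)))
    exact hK _ (isCluster_sameCluster (c (s₀ + 1))) _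
      (transGen_of_cycle (by omega) fun s => ⟨hall s, hall (s + 1), harc s⟩)
  obtain ⟨a, ha₁, ha₂⟩ : ∃ a, T.G2 (c a) (c (a + 1)) ∧ T.G2 (c (a + 1)) (c (a + 2)) := by
    obtain ⟨s, hs, hs'⟩ := h1
    rcases consecutive_of_g2 hc hG1 hs hs' hs₀ with rfl | rfl
    · exact ⟨s, hs', by rwa [add_assoc, one_add_one_eq_two] at hs₀⟩
    · exact ⟨s₀, hs₀, by rwa [add_assoc, one_add_one_eq_two] at hs'⟩
  have hn3 : 3 ≤ n := by
    by_contra hlt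
    obtain rfl : n = 2 := by omega
    rw [show a + 2 = a by rw [show (2 : ZMod 2) = 0 from rfl, add_zero]] at ha₂
    exact ha₁.asymm ha₂
  have hno2 : ∀ u : ZMod n, u ≠ u + 2 := fun u h => zmod_two_ne_zero hn3 (by simpa using h)
  have ha₂' : T.G2 (c (a + 1)) (c (a + 1 + 1)) := by
    rwa [add_assoc, one_add_one_eq_two]
  have hother : ∀ s, s ≠ a → s ≠ a + 1 → T.G3 (c s) (c (s + 1)) := by
    intro s hs hs'
    refine h23 s fun h2 => ?_
    have e1 : a = s + 1 := (consecutive_of_g2 hc hG1 hs h2 ha₁).resolve_right hs'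
    have e2 : s = a + 1 + 1 :=
      (consecutive_of_g2 hc hG1 hs' h2 ha₂').resolve_left
        fun h => hs (add_right_cancel h).symm
    -- A third (G2)-arc would be consecutive to both others and close a triangle. Its three strict
    -- inequalities contradict the sum of those from the three missing reverse arcs.
    obtain ⟨-, -, -, x₁, x₀, hx₁, hx₀, hm₁⟩ := ha₁
    obtain ⟨-, -, -, y₂, y₁, hy₂, hy₁, hm₂⟩ := ha₂'
    obtain ⟨-, -, -, z₀, z₂, hz₀, hz₂, hm₃⟩ := h2
    rw [← e2] at hy₂
    rw [← e1] at hz₀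
    have back : ∀ u v, u = v + 1 → ¬ T.G2 (c u) (c v) := by
      intro u v huv h
      have := (hc.2.2 u v).mp (.inr (.inl h))
      rw [huv, add_assoc, one_add_one_eq_two] at this
      exact hno2 v this
    have b1 := mean_le_of_not_g2 (hc.2.1.ne (by
      intro h
      simp only [add_eq_left] at h
      have : (2 : ZMod n) = 0 := by rw [← one_add_one_eq_two, h, add_zero]
      exact zmod_two_ne_zero hn3 this)) (hG1 _ _) (hG1 _ _) (back (a + 1) a rfl) hz₀ hy₁
    have b2 := mean_le_of_not_g2 (hc.2.1.ne hs.symm) (hG1 _ _) (hG1 _ _) (back a s e1) hy₂ hx₀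
    have b3 := mean_le_of_not_g2 (hc.2.1.ne hs') (hG1 _ _) (hG1 _ _) (back s (a + 1) e2) hx₁ hz₂
    linarith
  have htwo : T.IsTwoCycle c := ⟨hn3, hc, a, ha₁, ha₂, hother⟩
  have hone_ne : (1 : ZMod n) ≠ 0 := by
    intro h
    exact zmod_two_ne_zero hn3 (by rw [← one_add_one_eq_two, h, add_zero])
  have hG3in : T.G3 (c (a - 1)) (c a) := by
    have := hother (a - 1) (by simpa using hone_ne) (by
      intro h
      apply zmod_two_ne_zero hn3
      linear_combination -h)
    rwa [sub_add_cancel] at this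
  by_cases hcl : T.SameCluster (c a) (c (a + 1))
  · have h3 : T.G3 (c (a - 1)) (c (a - 1 + 1)) := by rwa [sub_add_cancel]
    refine ne_of_omega3 hA (C := c (a + 1)) (C₀ := c (a + 2)) ⟨n, c, _, a + 1, htwo,
      isCluster_sameCluster (c a), hcl, ⟨a - 1, h3, ?_⟩, rfl, ?_, ha₂, ?_⟩ (hconst _ _)
    · rw [sub_add_cancel]
      exact sameCluster_refl _
    · rw [add_assoc, one_add_one_eq_two]
    · rwa [add_sub_cancel_right]
  · have h3 : T.G3 (c (a - 1)) (c (a - 1 + 1)) := by rwa [sub_add_cancel]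
    refine ne_of_omega12 hA (C := c (a + 1)) (C₀ := c a) (.inr ⟨n, c, _, a, htwo,
      isCluster_sameCluster (c a), hcl, ⟨a - 1, h3, ?_⟩, rfl, rfl, ha₁, hG3in⟩) (hconst _ _)
    rw [sub_add_cancel]
    exact sameCluster_refl _

theorem acyclicOn_of_satisfies (hG3 : T.NoG3Cycle) (hK : ∀ K, T.IsCluster K → T.AcyclicOn K)
    {A : T.Cell → Bool} (hA : Satisfies A T.formula) (v : Bool) :
    T.AcyclicOn {C | A C = v} := by
  intro C h
  obtain ⟨n, c, hn, hinj, hr⟩ := exists_induced_cycle (fun _ h => h.2.2.ne rfl) h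
  have hv : ∀ s, A (c s) = v := fun s => ((hr s (s + 1)).mpr rfl).1
  exact no_induced_cycle hG3 hK hA (c := c)
    ⟨hn, hinj, fun s t => ⟨fun h => (hr s t).mp ⟨hv s, hv t, h⟩, fun h => ((hr s t).mpr h).2.2⟩⟩
    fun s t => (hv s).trans (hv t).symm

/-! ## Assignments defined by compatible orders -/

theorem eqClauses_of_eq {V : Type*} {A : V → Bool} {u v : V} (h : A u = A v) :
    ∀ κ ∈ eqClauses u v, A κ.1.1 = κ.1.2 ∨ A κ.2.1 = κ.2.2 := by
  rintro κ (rfl | rfl) <;> cases hv : A v <;> simp [h, hv]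

theorem neClauses_of_ne {V : Type*} {A : V → Bool} {u v : V} (h : A u ≠ A v) :
    ∀ κ ∈ neClauses u v, A κ.1.1 = κ.1.2 ∨ A κ.2.1 = κ.2.2 := by
  rintro κ (rfl | rfl) <;> cases hu : A u <;> cases hv : A v <;> simp_all

namespace Placement

variable {side : Bool → Y → Prop} {out : Bool → Y → Y → Prop}

theorem opposite_of_omega1 (P : Placement T side out) {C C₀ : T.Cell} (h : C₀ ∈ T.Omega1 C) :
    ∃ b, T.CellSide side b C₀ ∧ T.CellSide side (!b) C := by
  obtain ⟨n, c, K, s, ⟨hc, s₀, -, hs₀⟩, -, -, -, rfl, rfl, h2⟩ := h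
  have hn := hc.1
  obtain rfl : s = s₀ := by
    by_contra hne
    exact (hs₀ s hne).2.2.2.1 h2
  have := P.opposite_of_oneCycle (g := fun k : ℕ => c (s + k)) hn (by simp) (by simpa using h2) ?_
  · simpa using this
  · intro k hk hkn
    have hne : s + k ≠ s := by
      intro h
      have := zmod_add_natCast_inj (s := s) (k := 0) (l := k) (by omega) (by omega) (by simpa using h)
      omega
    have := hs₀ _ hne
    rwa [add_assoc, ← Nat.cast_succ] at this

theorem g3_of_twoCycle {n : ℕ} {c : ZMod n → T.Cell} {s : ZMod n}
    (h : ∀ u, u ≠ s → u ≠ s + 1 → T.G3 (c u) (c (u + 1))) (k : ℕ) (hk : 2 ≤ k) (hkn : k < n) :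
    T.G3 (c (s + k)) (c (s + (k + 1 : ℕ))) := by
  have h0 : s + k ≠ s := by
    intro h
    have := zmod_add_natCast_inj (s := s) (k := 0) (l := k) (by omega) (by omega) (by simpa using h)
    omega
  have h1 : s + k ≠ s + 1 := by
    intro h
    have := zmod_add_natCast_inj (s := s) (k := 1) (l := k) (by omega) (by omega) (by simpa using h)
    omega
  have := h _ h0 h1
  rwa [add_assoc, ← Nat.cast_succ] at this

/-- Counted from the start of the first (G2)-arc, the heads of (G3)-arcs have positions `3, …, n`;
position `n`, rather than `0`, stands for the start itself. -/
theorem exists_index_of_g3 {n : ℕ} {c : ZMod n → T.Cell} {s u : ZMod n} (hn : 3 ≤ n)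
    (h0 : T.G2 (c s) (c (s + 1))) (h1 : T.G2 (c (s + 1)) (c (s + 2)))
    (hu : T.G3 (c u) (c (u + 1))) : ∃ t : ℕ, 2 < t ∧ t ≤ n ∧ u + 1 = s + t := by
  have : NeZero n := ⟨by omega⟩
  have hk : s + ((u - s).val : ZMod n) = u := by simp
  have hlt := ZMod.val_lt (u - s)
  generalize (u - s).val = k at hk hlt
  subst hk
  refine ⟨k + 1, ?_, hlt, by push_cast; ring⟩
  by_contra hle
  rcases (by omega : k = 0 ∨ k = 1) with rfl | rfl
  · simp only [Nat.cast_zero, add_zero] at hu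
    exact hu.2.2.2.1 h0
  · simp only [Nat.cast_one] at hu
    rw [add_assoc s, one_add_one_eq_two] at hu
    exact hu.2.2.2.1 h1

theorem opposite_of_omega2 (P : Placement T side out) {C C₀ : T.Cell} (h : C₀ ∈ T.Omega2 C) :
    ∃ b, T.CellSide side b C₀ ∧ T.CellSide side (!b) C := by
  obtain ⟨n, c, K, s, ⟨hn, hc, s₀, h0, h1, hs₀⟩, ⟨D, rfl⟩, hCK, ⟨u, hu, huK⟩, rfl, rfl, h2, h3⟩ := h
  obtain rfl : s = s₀ := by
    by_contra hne
    by_cases hne' : s = s₀ + 1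
    · subst hne'
      rw [add_sub_cancel_right] at h3
      exact h3.2.2.2.1 h0
    · exact (hs₀ s hne hne').2.2.2.1 h2
  obtain ⟨t, ht, htn, hut⟩ := exists_index_of_g3 hn h0 h1 hu
  have hG3 := g3_of_twoCycle hs₀
  have := P.opposite_of_twoCycle_first (g := fun k : ℕ => c (s + k)) hn (by simp) (by simp)
    (by simpa using h0) (by simpa using h1) hG3 ?_ ht htn ?_
  · simpa using this
  · intro k hk hkn
    have hne : s + k ≠ s + (2 : ℕ) := by
      intro h
      have := zmod_add_natCast_inj (s := s) (k := 2) (l := k) (by omega) (by omega) h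
      omega
    have hind : T.Arc (c (s + (2 : ℕ))) (c (s + k)) →
        T.G3 (c (s + (2 : ℕ))) (c (s + k)) := by
      intro h
      have := (hc.2.2 _ _).mp h
      rw [this, add_assoc s, ← Nat.cast_succ]
      exact hG3 2 le_rfl hn
    exact ⟨hc.2.1.ne hne, fun h => (hind (.inl h)).2.1 h,
      fun h => (hind (.inr (.inl h))).2.2.2.1 h⟩
  · intro hcl
    rw [hut] at huK
    exact hCK (sameCluster_trans huK (by simpa using hcl))

theorem opposite_of_omega3 (P : Placement T side out) {C C₀ : T.Cell} (h : C₀ ∈ T.Omega3 C) :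
    ∃ b, T.CellSide side b C ∧ T.CellSide side (!b) C₀ := by
  obtain ⟨n, c, K, s, ⟨hn, hc, s₀, h0, h1, hs₀⟩, ⟨D, rfl⟩, hCK, ⟨u, hu, huK⟩, rfl, rfl, h2, h3⟩ := h
  have hmem : ∀ v, T.G2 (c v) (c (v + 1)) → v = s₀ ∨ v = s₀ + 1 := by
    intro v hv
    by_contra! hne
    exact (hs₀ v hne.1 hne.2).2.2.2.1 hv
  obtain rfl : s = s₀ + 1 := by
    refine (hmem s h2).resolve_left ?_
    rintro rfl
    rcases hmem (s - 1) (by rwa [sub_add_cancel]) with h | h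
    · apply zmod_two_ne_zero hn
      linear_combination -2 * h
    · apply zmod_two_ne_zero hn
      linear_combination -h
  obtain ⟨t, ht, htn, hut⟩ := exists_index_of_g3 hn h0 h1 hu
  have hG3 := g3_of_twoCycle hs₀
  have := P.opposite_of_twoCycle_second (g := fun k : ℕ => c (s₀ + k)) hn (by simp)
    (by simpa using h0) (by simpa using h1) hG3 ht htn ?_ ?_
  · simpa [add_assoc, one_add_one_eq_two] using this
  · rw [hut] at huK
    simpa using sameCluster_trans (sameCluster_symm huK) hCK
  · refine hc.2.1.ne fun h => ?_
    have := zmod_add_natCast_inj (s := s₀) (k := 1) (l := t) (by omega) (by omega) h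
    omega

/-- An assignment that agrees with the location of the cells in the bounding holes satisfies the
formula. -/
theorem satisfies (P : Placement T side out) {A : T.Cell → Bool}
    (hA : ∀ b C, T.CellSide side b C → A C = b) : Satisfies A T.formula := by
  have hopp : ∀ {C C' : T.Cell}, (∃ b, T.CellSide side b C ∧ T.CellSide side (!b) C') →
      A C ≠ A C' := by
    rintro C C' ⟨b, h, h'⟩
    rw [hA b C h, hA _ C' h']
    simp
  rintro κ (⟨C, C', h, hκ⟩ | ⟨C, C', h, hκ⟩ | ⟨C, C₀, h, hκ⟩ | ⟨C, C₀, h, hκ⟩)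
  · refine eqClauses_of_eq ?_ κ hκ
    rcases P.side_of_sameCluster h with rfl | ⟨b, h, h'⟩
    · rfl
    · rw [hA b C h, hA b C' h']
  · exact neClauses_of_ne (hopp (P.side_of_twinClusters h)) κ hκ
  · refine neClauses_of_ne (Ne.symm (hopp ?_)) κ hκ
    rcases h with h | h
    · exact P.opposite_of_omega1 h
    · exact P.opposite_of_omega2 h
  · exact neClauses_of_ne (hopp (P.opposite_of_omega3 h)) κ hκ

end Placement

end LocalData

end SeriationFit

namespace SeriationFit

/-! ## Compatible orders refine the canonical order or its dual -/

theorem IsCompatibleOrder.swap {X : Type*} {d : X → X → ℝ} {ε : ℝ} (hd : IsDissimilarity d)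
    {le : X → X → Prop} (h : IsCompatibleOrder d ε le) :
    IsCompatibleOrder d ε (fun x y => le y x) := by
  have := h.1
  refine ⟨{ refl := fun x => refl_of le x
            trans := fun _ _ _ h h' => trans_of le h' h
            antisymm := fun _ _ h h' => antisymm_of le h' h
            total := fun x y => total_of le y x }, fun x _ u _ v _ y _ h1 h2 h3 => ?_⟩
  rw [hd.symm u v, hd.symm x y]
  exact h.2 y trivial v trivial u trivial x trivial h3 h2 h1

theorem MustBetween.between {X : Type*} {d : X → X → ℝ} {ε : ℝ} (hd : IsDissimilarity d)
    (hε : 0 ≤ ε) {le : X → X → Prop} (h : IsCompatibleOrder d ε le) {x z y : X}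
    (hb : MustBetween d ε x z y) :
    ((le x z ∧ le z y) ∨ (le y z ∧ le z x)) ∧ x ≠ z ∧ z ≠ y ∧ x ≠ y := by
  have hlin := h.1
  have hb : max (d x z) (d z y) + 2 * ε < d x y := hb
  have h1 := le_max_left (d x z) (d z y)
  have h2 := le_max_right (d x z) (d z y)
  have hc : ∀ x u v y, le x u → le u v → le v y → d u v ≤ d x y + 2 * ε := fun x u v y =>
    h.2 x trivial u trivial v trivial y trivial
  refine ⟨?_, ?_, ?_, ?_⟩
  · rcases total_of le x z with hxz | hxz <;> rcases total_of le z y with hzy | hzy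
    · exact .inl ⟨hxz, hzy⟩
    · exfalso
      rcases total_of le x y with hxy | hxy
      · have := hc x x y z (refl_of le x) hxy hzy
        linarith
      · have := hc y y x z (refl_of le y) hxy hxz
        rw [hd.symm y x, hd.symm y z] at this
        linarith
    · exfalso
      rcases total_of le x y with hxy | hxy
      · have := hc z x y y hxz hxy (refl_of le y)
        linarith
      · have := hc z y x x hzy hxy (refl_of le x)
        rw [hd.symm y x, hd.symm z x] at this
        linarith
    · exact .inr ⟨hzy, hxz⟩
  · rintro rfl
    linarith
  · rintro rfl
    linarith
  · rintro rfl
    have := hd.nonneg x z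
    rw [hd.self x] at hb
    linarith

/-- The forced middle position, with the three elements distinct, determines the order of the whole
triplet from any one comparison in it. -/
theorem Closure.le_of_compatible {X : Type*} {d : X → X → ℝ} {ε : ℝ} (hd : IsDissimilarity d)
    (hε : 0 ≤ ε) {le : X → X → Prop} (h : IsCompatibleOrder d ε le) {S : X → X → Prop}
    (hS : ∀ x y, S x y → le x y) {x y : X} (hxy : Closure d ε S x y) : le x y := by
  have hlin := h.1
  induction hxy with
  | base h => exact hS _ _ h
  | refl x => exact refl_of le x
  | trans _ _ ih ih' => exact trans_of le ih ih'
  | middle_right hb _ ih =>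
    obtain ⟨h | h, hne, -⟩ := hb.between hd hε h
    · exact h.2
    · exact absurd (antisymm_of le ih h.2) hne
  | middle_left hb _ ih =>
    obtain ⟨h | h, hne, -⟩ := hb.between hd hε h
    · exact absurd (antisymm_of le h.1 ih) hne
    · exact h.1
  | ends_left hb _ ih =>
    obtain ⟨h | h, -, -, hne⟩ := hb.between hd hε h
    · exact h.1
    · exact absurd (antisymm_of le ih (trans_of le h.1 h.2)) hne
  | ends_right hb _ ih =>
    obtain ⟨h | h, -, -, hne⟩ := hb.between hd hε h
    · exact h.2
    · exact absurd (antisymm_of le ih (trans_of le h.1 h.2)) hne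

theorem IsCanonical.trans {X : Type*} {d : X → X → ℝ} {ε : ℝ} {R : X → X → Prop}
    (h : IsCanonical d ε R) {x y z : X} (hxy : R x y) (hyz : R y z) : R x z := by
  cases h <;> exact .trans hxy hyz

theorem exists_threshold {p : ℕ} {P : Fin p → Prop} (hP : ∀ m n, m ≤ n → P n → P m) :
    ∃ i ≤ p, ∀ m : Fin p, P m ↔ m.val + 1 ≤ i := by
  classical
  by_cases h : ∃ k, ∃ hk : k < p, ¬ P ⟨k, hk⟩
  · obtain ⟨hk, hPk⟩ := Nat.find_spec h
    refine ⟨Nat.find h, hk.le, fun m => ⟨fun hm => ?_, fun hm => ?_⟩⟩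
    · by_contra hlt
      exact hPk (hP _ m (show Nat.find h ≤ m.val by omega) hm)
    · by_contra hm'
      exact Nat.find_min h hm ⟨m.2, hm'⟩
  · push Not at h
    exact ⟨p, le_rfl, fun m => ⟨fun _ => m.2, fun _ => h m.val m.2⟩⟩

theorem exists_inHole {X : Type*} {le : X → X → Prop} (hle : IsLinearOrder X le) {p : ℕ}
    {a : Fin p → X} (hmono : ∀ m n, m ≤ n → le (a m) (a n)) (x : X) :
    ∃ k ≤ p, InHole a le x k := by
  obtain ⟨k, hk, h⟩ := exists_threshold (P := fun m => le (a m) x)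
    fun m n hmn hn => trans_of le (hmono m n hmn) hn
  refine ⟨k, hk, fun m => ⟨(h m).mpr, fun hm => (total_of le x (a m)).resolve_right ?_⟩⟩
  rw [h m]
  omega

theorem exists_hasSegment {X : Type*} {R : X → X → Prop} {p : ℕ} {a : Fin p → X}
    (htrans : ∀ x y z, R x y → R y z → R x z) (ha : ∀ m n, m ≤ n → R (a m) (a n)) (x : X) :
    ∃ i j, i ≤ p ∧ 1 ≤ j ∧ HasSegment R a x i j := by
  obtain ⟨i, hi, h⟩ := exists_threshold (P := fun m => R (a m) x)
    fun m n hmn hn => htrans _ _ _ (ha m n hmn) hn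
  obtain ⟨j, hj, h'⟩ := exists_threshold (P := fun m => ¬ R x (a m))
    fun m n hmn hn hm => hn (htrans _ _ _ hm (ha m n hmn))
  refine ⟨i, j + 1, hi, by omega, by omega, h, fun m => ?_⟩
  have := h' m
  constructor
  · intro hm
    by_contra hlt
    exact this.mpr (by omega) hm
  · intro hm
    by_contra hx
    have := this.mp hx
    omega

/-- The bounds on `i` and `j` are needed because `HasSegment` does not distinguish values of `i`
from `p` upwards, nor `j = 0` from `j = 1`. -/
theorem HasSegment.bounds_of_inHole {X : Type*} {R : X → X → Prop} {p : ℕ} {a : Fin p → X}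
    {x : X} {i j k : ℕ} (hs : HasSegment R a x i j) (hi : i ≤ p) (hj : 1 ≤ j) {le : X → X → Prop}
    (hle : IsLinearOrder X le) (hext : ∀ x y, R x y → le x y) (hx : x ∉ Set.range a)
    (hkp : k ≤ p) (hk : InHole a le x k) : i ≤ k ∧ k < j := by
  constructor <;> by_contra hlt
  · have h1 := hext _ _ ((hs.2.1 ⟨k, by omega⟩).mpr (by simp only; omega))
    have h2 := (hk ⟨k, by omega⟩).2 (by simp)
    exact hx ⟨_, antisymm_of le h1 h2⟩
  · have h1 := hext _ _ ((hs.2.2 ⟨j - 1, by omega⟩).mpr (by simp only; omega))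
    have h2 := (hk ⟨j - 1, by omega⟩).1 (by simp only; omega)
    exact hx ⟨_, antisymm_of le h2 h1⟩

/-- An element off a maximal chain is incomparable with some element of the chain. -/
theorem HasSegment.succ_lt {X : Type*} {R : X → X → Prop} {p : ℕ} {a : Fin p → X}
    {x : X} {i j : ℕ} (hs : HasSegment R a x i j) (ha : IsMaximalChain R a)
    (hx : x ∉ Set.range a) : i + 1 < j := by
  obtain ⟨m, h1, h2⟩ : ∃ m, ¬ R (a m) x ∧ ¬ R x (a m) := by
    by_contra! h
    refine hx ?_
    have hc : IsChain R (insert x (Set.range a)) := by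
      refine ha.2.1.insert ?_
      rintro _ ⟨m, rfl⟩ -
      by_cases hm : R (a m) x
      · exact .inr hm
      · exact .inl (h m hm)
    rw [ha.2.2 hc (Set.subset_insert _ _)]
    exact Set.mem_insert _ _
  rw [hs.2.1] at h1
  rw [hs.2.2] at h2
  omega

/-- The order `le` itself serves as every required witness, and the hole in which it places `y`
serves as `k'`. -/
theorem inAH_of_compatible {X : Type*} {d : X → X → ℝ} {ε : ℝ} {R le : X → X → Prop}
    (htrans : ∀ x y z, R x y → R y z → R x z) (hle : IsCompatibleOrder d ε le)
    (hext : ∀ x y, R x y → le x y) {p : ℕ} {a : Fin p → X} (ha : ∀ m n, m ≤ n → R (a m) (a n))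
    {x : X} {i j k : ℕ} (hs : HasSegment R a x i j) (hik : i ≤ k)
    (hkj : k < j) (hk : InHole a le x k) : InAH d ε R a x k := by
  have hadm : Admissible d ε R a x k :=
    ⟨⟨i, j, hs, hik, hkj⟩, le, hle.1, fun x _ y _ => hext x y, hk,
      fun x _ u _ v _ y _ => hle.2 x trivial u trivial v trivial y trivial⟩
  refine ⟨hadm, fun y hy _ => ?_⟩
  obtain ⟨k', hk'p, hk'⟩ := exists_inHole hle.1 (fun m n h => hext _ _ (ha m n h)) y
  obtain ⟨i', j', hi', hj', hs'⟩ := exists_hasSegment htrans ha y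
  obtain ⟨h1, h2⟩ := hs'.bounds_of_inHole hi' hj' hle.1 hext hy hk'p hk'
  refine ⟨k', hadm, ⟨⟨i', j', hs', h1, h2⟩, le, hle.1, fun x _ y _ => hext x y, hk',
      fun x _ u _ v _ y _ => hle.2 x trivial u trivial v trivial y trivial⟩,
    le, hle.1, fun x _ y _ => hext x y, hk, hk', ?_⟩
  rw [one_mul]
  exact fun x _ u _ v _ y _ => hle.2 x trivial u trivial v trivial y trivial

theorem IsCanonical.refines {X : Type*} {d : X → X → ℝ} (hd : IsDissimilarity d) {ε : ℝ}
    (hε : 0 ≤ ε) {R : X → X → Prop} (hR : IsCanonical d ε R) {le : X → X → Prop}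
    (hle : IsCompatibleOrder d ε le) : (∀ x y, R x y → le x y) ∨ (∀ x y, R x y → le y x) := by
  induction hR with
  | init s t hst =>
    have hlin := hle.1
    rcases total_of le s t with h | h
    · exact .inl fun x y => Closure.le_of_compatible hd hε hle
        (by rintro _ _ ⟨rfl, rfl⟩; exact h)
    · exact .inr fun x y => Closure.le_of_compatible hd hε (hle.swap hd)
        (by rintro _ _ ⟨rfl, rfl⟩; exact h)
  | @augment_left R p a x i j m hR ha hx hs hAH hm ih =>
    have key : ∀ le, IsCompatibleOrder d ε le → (∀ x y, R x y → le x y) → ∀ u v,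
        Closure d ε (fun u v => R u v ∨ (u = a m ∧ v = x)) u v → le u v := by
      intro le hle hext u v
      refine Closure.le_of_compatible hd hε hle ?_
      rintro u v (h | ⟨rfl, rfl⟩)
      · exact hext _ _ h
      have hlin := hle.1
      -- Since `m.val = i`, the chain element here is `a_{i+1}`. An order placing the new element
      -- before it would locate that element in `H_i` and so certify the hole that is not in `AH`.
      refine (total_of le (a m) v).resolve_right fun hxm => hAH ?_
      have hmono : ∀ m n, m ≤ n → R (a m) (a n) := fun m n h => (ha.1 m n).mpr h
      have hij := hs.succ_lt ha hx
      refine inAH_of_compatible (R := R) (fun _ _ _ => hR.trans) hle hext hmono hs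
        le_rfl (show i < j by omega)
        fun n => ⟨fun hn => hext _ _ ((hs.2.1 n).mpr hn), fun (hn : i < n.val + 1) => ?_⟩
      have hmn : m ≤ n := Fin.le_def.mpr (by omega)
      exact trans_of le hxm (hext _ _ (hmono m n hmn))
    exact ih.imp (key le hle) (key _ (hle.swap hd))
  | @augment_right R p a x i j m hR ha hx hs hAH hm ih =>
    have key : ∀ le, IsCompatibleOrder d ε le → (∀ x y, R x y → le x y) → ∀ u v,
        Closure d ε (fun u v => R u v ∨ (u = x ∧ v = a m)) u v → le u v := by
      intro le hle hext u v
      refine Closure.le_of_compatible hd hε hle ?_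
      rintro u v (h | ⟨rfl, rfl⟩)
      · exact hext _ _ h
      have hlin := hle.1
      refine (total_of le u (a m)).resolve_right fun hxm => hAH ?_
      have hmono : ∀ m n, m ≤ n → R (a m) (a n) := fun m n h => (ha.1 m n).mpr h
      have hij := hs.succ_lt ha hx
      refine inAH_of_compatible (R := R) (fun _ _ _ => hR.trans) hle hext hmono hs
        (show i ≤ j - 1 by omega) (show j - 1 < j by omega)
        fun n => ⟨fun hn => ?_, fun hn => hext _ _ ((hs.2.2 n).mpr (by omega))⟩
      have hnm : n ≤ m := Fin.le_def.mpr (by omega)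
      exact trans_of le (hext _ _ (hmono n m hnm)) hxm
    exact ih.imp (key le hle) (key _ (hle.swap hd))

end SeriationFit

namespace SeriationFit

/-! ## The location of the elements of `X_{ij}` in a compatible order -/

section Location

variable {X : Type*} {d : X → X → ℝ} {ε : ℝ} {R : X → X → Prop} {p : ℕ} {a : Fin p → X} {i j : ℕ}

/-- The distances from `x` to the elements `a_k` with `i < k < j` differ from `d_x` by at most
`ε`. -/
theorem dist_chain_mem (hd : IsDissimilarity d) (ha : IsMaximalChain R a)
    (hAH : BoundingHolesAdmissible d ε R a) (x : Xset R a i j) (m : Fin p) (him : i < m.val + 1)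
    (hmj : m.val + 1 < j) : d x.1 (a m) ≤ (localData d ε R a i j).mean x + ε ∧
      (localData d ε R a i j).mean x ≤ d x.1 (a m) + ε := by
  obtain ⟨hx, hs⟩ := x.2
  obtain ⟨⟨⟨-, le₁, hlin₁, hext₁, hin₁, hc₁⟩, -⟩, ⟨⟨-, le₂, hlin₂, hext₂, hin₂, hc₂⟩, -⟩⟩ :=
    hAH x.1 hx i j hs
  have hmem : ∀ n, a n ∈ Set.range a ∪ {x.1} := fun n => .inl ⟨n, rfl⟩
  have hxmem : x.1 ∈ Set.range a ∪ {x.1} := .inr rfl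
  -- With `x` in `H_i` the distances to the inner chain elements increase up to `2 ε`, with `x` in
  -- `H_{j-1}` they decrease. The two orders may be unrelated; each contributes one inequality.
  have hmono : ∀ m n : Fin p, i < m.val + 1 → m.val + 1 < j → i < n.val + 1 → n.val + 1 < j →
      m ≤ n → d x.1 (a m) ≤ d x.1 (a n) + 2 * ε ∧ d x.1 (a n) ≤ d x.1 (a m) + 2 * ε := by
    intro m n h1 h2 h3 h4 hmn
    have hRmn := (ha.1 m n).mpr hmn
    constructor
    · exact hc₁ _ hxmem _ hxmem _ (hmem m) _ (hmem n) (refl_of le₁ _) ((hin₁ m).2 h1)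
        (hext₁ _ (hmem m) _ (hmem n) hRmn)
    · rw [hd.symm x.1 (a n), hd.symm x.1 (a m)]
      exact hc₂ _ (hmem m) _ (hmem n) _ hxmem _ hxmem (hext₂ _ (hmem m) _ (hmem n) hRmn)
        ((hin₂ n).1 (by omega)) (refl_of le₂ _)
  have hall : ∀ s ∈ innerDistances d a i j x.1, ∀ t ∈ innerDistances d a i j x.1,
      s ≤ t + 2 * ε := by
    rintro _ ⟨m, h1, h2, rfl⟩ _ ⟨n, h3, h4, rfl⟩
    rcases le_total m n with h | h
    · exact (hmono m n h1 h2 h3 h4 h).1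
    · exact (hmono n m h3 h4 h1 h2 h).2
  have hfin : (innerDistances d a i j x.1).Finite :=
    (Set.finite_range fun m => d x.1 (a m)).subset (by
      rintro _ ⟨m, -, -, rfl⟩
      exact ⟨m, rfl⟩)
  have hm : d x.1 (a m) ∈ innerDistances d a i j x.1 := ⟨m, him, hmj, rfl⟩
  have h1 := hall _ (Set.Nonempty.csSup_mem ⟨_, hm⟩ hfin) _ (Set.Nonempty.csInf_mem ⟨_, hm⟩ hfin)
  have h2 := csInf_le hfin.bddBelow hm
  have h3 := le_csSup hfin.bddAbove hm
  change _ ≤ (sInf _ + sSup _) / 2 + ε ∧ (sInf _ + sSup _) / 2 ≤ _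
  constructor <;> linarith

variable {le : X → X → Prop}

theorem inHole_unique (hle : IsLinearOrder X le) {x : X} (hx : x ∉ Set.range a) {k l : ℕ}
    (hk : InHole a le x k) (hl : InHole a le x l) (hkp : k ≤ p) (hlp : l ≤ p) : k = l := by
  by_contra hne
  rcases Nat.lt_or_gt_of_ne hne with h | h
  · exact hx ⟨_, antisymm_of le ((hl ⟨k, by omega⟩).1 h) ((hk ⟨k, by omega⟩).2 (by simp))⟩
  · exact hx ⟨_, antisymm_of le ((hk ⟨l, by omega⟩).1 h) ((hl ⟨l, by omega⟩).2 (by simp))⟩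

theorem exists_inHole_xset (hle : IsLinearOrder X le) (hext : ∀ x y, R x y → le x y)
    (ha : IsMaximalChain R a) (x : Xset R a i j) :
    ∃ k, i ≤ k ∧ k < j ∧ InHole a le x.1 k := by
  obtain ⟨k, hkp, hk⟩ := exists_inHole hle (fun m n h => hext _ _ ((ha.1 m n).mpr h)) x.1
  have hij := x.2.2.succ_lt ha x.2.1
  have hj := x.2.2.1
  obtain ⟨h1, h2⟩ := x.2.2.bounds_of_inHole (by omega) (by omega) hle hext x.2.1 hkp hk
  exact ⟨k, h1, h2, hk⟩

/-- Two elements before an element `a_k` with `i < k < j`. -/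
theorem bounds_before (hd : IsDissimilarity d) (ha : IsMaximalChain R a)
    (hAH : BoundingHolesAdmissible d ε R a) (hle : IsCompatibleOrder d ε le)
    {x y : Xset R a i j} {m : Fin p} (him : i < m.val + 1) (hmj : m.val + 1 < j)
    (hxy : le x.1 y.1) (hy : le y.1 (a m)) :
    d x.1 y.1 ≤ (localData d ε R a i j).mean x + 3 * ε ∧
      (localData d ε R a i j).mean y ≤ (localData d ε R a i j).mean x + 4 * ε := by
  have hlin := hle.1
  -- Compatibility costs `2 ε`, and each replacement of a distance to `a m` by a mean costs `ε`:
  -- once for the first bound, twice for the second.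
  have h1 := dist_chain_mem hd ha hAH x m him hmj
  have h2 := dist_chain_mem hd ha hAH y m him hmj
  have h3 := hle.2 x.1 trivial x.1 trivial y.1 trivial (a m) trivial (refl_of le _) hxy hy
  have h4 := hle.2 x.1 trivial y.1 trivial (a m) trivial (a m) trivial hxy hy (refl_of le _)
  constructor <;> linarith [h1.1, h2.2]

/-- Two elements after an element `a_k` with `i < k < j`. -/
theorem bounds_after (hd : IsDissimilarity d) (ha : IsMaximalChain R a)
    (hAH : BoundingHolesAdmissible d ε R a) (hle : IsCompatibleOrder d ε le)
    {x y : Xset R a i j} {m : Fin p} (him : i < m.val + 1) (hmj : m.val + 1 < j)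
    (hxy : le x.1 y.1) (hx : le (a m) x.1) :
    d x.1 y.1 ≤ (localData d ε R a i j).mean y + 3 * ε ∧
      (localData d ε R a i j).mean x ≤ (localData d ε R a i j).mean y + 4 * ε := by
  have hlin := hle.1
  have h1 := dist_chain_mem hd ha hAH x m him hmj
  have h2 := dist_chain_mem hd ha hAH y m him hmj
  have h3 := hle.2 (a m) trivial x.1 trivial y.1 trivial y.1 trivial hx hxy (refl_of le _)
  have h4 := hle.2 (a m) trivial (a m) trivial x.1 trivial y.1 trivial (refl_of le _) hx hxy
  rw [hd.symm (a m) y.1] at h3 h4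
  rw [hd.symm (a m) x.1] at h4
  constructor <;> linarith [h1.2, h2.1]

/-- Linked elements are not in different holes. -/
theorem not_link_of_lt (hd : IsDissimilarity d) (ha : IsMaximalChain R a)
    (hAH : BoundingHolesAdmissible d ε R a) (hle : IsCompatibleOrder d ε le)
    {x y : Xset R a i j} {k l : ℕ} (hik : i ≤ k) (hkl : k < l) (hlj : l < j)
    (hx : InHole a le x.1 k) (hy : InHole a le y.1 l) : ¬ (localData d ε R a i j).Link x y := by
  have hlin := hle.1
  have hj := x.2.2.1
  -- Index `l - 1` is the chain element `a_l`, which separates `H_k` from `H_l` and satisfies `i < l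
  -- < j`.
  have hm : l - 1 < p := by omega
  have h1 := dist_chain_mem hd ha hAH x ⟨l - 1, hm⟩ (by simp only; omega) (by simp only; omega)
  have h2 := dist_chain_mem hd ha hAH y ⟨l - 1, hm⟩ (by simp only; omega) (by simp only; omega)
  have hxm := (hx ⟨l - 1, hm⟩).2 (by simp only; omega)
  have hym := (hy ⟨l - 1, hm⟩).1 (by simp only; omega)
  have h3 := hle.2 _ trivial _ trivial _ trivial _ trivial (refl_of le _) hxm hym
  have h4 := hle.2 _ trivial _ trivial _ trivial _ trivial hxm hym (refl_of le _)
  rw [hd.symm _ y.1] at h4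
  refine not_lt.mpr (max_le ?_ ?_) <;> change _ ≤ d x.1 y.1 + 3 * ε <;> linarith [h1.2, h2.2]

theorem inHole_of_link (hd : IsDissimilarity d) (ha : IsMaximalChain R a)
    (hAH : BoundingHolesAdmissible d ε R a) (hle : IsCompatibleOrder d ε le)
    (hext : ∀ x y, R x y → le x y) {x y : Xset R a i j} {k : ℕ} (hik : i ≤ k) (hkj : k < j)
    (h : (localData d ε R a i j).Link x y) (hx : InHole a le x.1 k) : InHole a le y.1 k := by
  obtain ⟨l, hil, hlj, hy⟩ := exists_inHole_xset hle.1 hext ha y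
  rcases lt_trichotomy k l with hlt | rfl | hlt
  · exact absurd h (not_link_of_lt hd ha hAH hle hik hlt hlj hx hy)
  · exact hy
  · refine absurd ?_ (not_link_of_lt hd ha hAH hle hil hlt hkj hy hx)
    unfold LocalData.Link at *
    rw [max_comm]
    change d y.1 x.1 + _ < _
    rw [hd.symm]
    exact h

theorem inHole_of_sep (hd : IsDissimilarity d) (ha : IsMaximalChain R a)
    (hAH : BoundingHolesAdmissible d ε R a) (hle : IsCompatibleOrder d ε le)
    (hext : ∀ x y, R x y → le x y) {x y : Xset R a i j}
    (h : (localData d ε R a i j).Sep x y) (hxy : le x.1 y.1) :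
    InHole a le x.1 i ∧ InHole a le y.1 (j - 1) := by
  have hlin := hle.1
  have hj := x.2.2.1
  have hij := x.2.2.succ_lt ha x.2.1
  obtain ⟨k, hik, hkj, hx⟩ := exists_inHole_xset hle.1 hext ha x
  obtain ⟨l, hil, hlj, hy⟩ := exists_inHole_xset hle.1 hext ha y
  have h : max ((localData d ε R a i j).mean x) ((localData d ε R a i j).mean y) + 3 * ε
    < d x.1 y.1 := h
  have h1 := le_max_left ((localData d ε R a i j).mean x) ((localData d ε R a i j).mean y)
  have h2 := le_max_right ((localData d ε R a i j).mean x) ((localData d ε R a i j).mean y)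
  have hki : k = i := by
    by_contra hne
    have := (bounds_after hd ha hAH hle (m := ⟨k - 1, by omega⟩) (by simp only; omega)
      (by simp only; omega) hxy ((hx _).1 (by simp only; omega))).1
    linarith
  have hlj' : l = j - 1 := by
    by_contra hne
    have := (bounds_before hd ha hAH hle (m := ⟨l, by omega⟩) (by simp only; omega)
      (by simp only; omega) hxy ((hy _).2 (by simp only; omega))).1
    linarith
  exact ⟨hki ▸ hx, hlj' ▸ hy⟩

/-- The location of the elements of `X_{ij}` in an `ε`-compatible order that refines the canonical
order. -/
theorem placement_of_compatible (hd : IsDissimilarity d) (hε : 0 ≤ ε) (ha : IsMaximalChain R a)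
    (hAH : BoundingHolesAdmissible d ε R a) (hle : IsCompatibleOrder d ε le)
    (hext : ∀ x y, R x y → le x y) :
    (localData d ε R a i j).Placement (fun b x => InHole a le x.1 (cond b (j - 1) i))
      (fun b x y => x ≠ y ∧ cond b (le x.1 y.1) (le y.1 x.1)) := by
  have hlin := hle.1
  have hc : ∀ x u v y, le x u → le u v → le v y → d u v ≤ d x y + 2 * ε := fun x u v y =>
    hle.2 x trivial u trivial v trivial y trivial
  have hcond : ∀ b : Bool, i + 1 < j → i ≤ cond b (j - 1) i ∧ cond b (j - 1) i < j := by
    intro b h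
    cases b <;> simp only [cond_true, cond_false] <;> omega
  refine
    { eps_nonneg := hε
      symm := fun x y => hd.symm x.1 y.1
      out_asymm := ?_, out_trans := ?_, out_total := ?_, between_left := ?_, between_right := ?_
      side_disjoint := ?_, side_of_link := ?_, side_of_sep := ?_, side_of_mean := ?_
      mean_le := ?_, cross := ?_ }
  · rintro (_ | _) x y ⟨hne, h⟩ ⟨-, h'⟩
    · exact hne (Subtype.ext (antisymm_of le h' h))
    · exact hne (Subtype.ext (antisymm_of le h h'))
  · rintro (_ | _) x y z ⟨hne, h⟩ ⟨-, h'⟩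
    · refine ⟨?_, trans_of le h' h⟩
      rintro rfl
      exact hne (Subtype.ext (antisymm_of le h' h))
    · refine ⟨?_, trans_of le h h'⟩
      rintro rfl
      exact hne (Subtype.ext (antisymm_of le h h'))
  · intro b x y
    by_cases hxy : x = y
    · exact .inr (.inl hxy)
    · rcases total_of le x.1 y.1 with h | h <;> cases b
      · exact .inr (.inr ⟨Ne.symm hxy, h⟩)
      · exact .inl ⟨hxy, h⟩
      · exact .inl ⟨hxy, h⟩
      · exact .inr (.inr ⟨Ne.symm hxy, h⟩)
  · rintro (_ | _) u w v ⟨-, h⟩ ⟨-, h'⟩ <;> change d u.1 w.1 ≤ d u.1 v.1 + 2 * ε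
    · rw [hd.symm u.1 w.1, hd.symm u.1 v.1]
      exact hc _ _ _ _ h' h (refl_of le _)
    · exact hc _ _ _ _ (refl_of le _) h h'
  · rintro (_ | _) u w v ⟨-, h⟩ ⟨-, h'⟩ <;> change d w.1 v.1 ≤ d u.1 v.1 + 2 * ε
    · rw [hd.symm w.1 v.1, hd.symm u.1 v.1]
      exact hc _ _ _ _ (refl_of le _) h' h
    · exact hc _ _ _ _ h h' (refl_of le _)
  · intro b x h h'
    have hj := x.2.2.1
    have hij := x.2.2.succ_lt ha x.2.1
    have h1 := hcond b hij
    have h2 := hcond (!b) hij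
    have := inHole_unique hle.1 x.2.1 h h' (by omega) (by omega)
    cases b <;> simp only [Bool.not_false, Bool.not_true, cond_true, cond_false] at this <;> omega
  · intro b x y h hx
    have h1 := hcond b (x.2.2.succ_lt ha x.2.1)
    exact inHole_of_link hd ha hAH hle hext h1.1 h1.2 h hx
  · intro x y h
    rcases total_of le x.1 y.1 with hxy | hxy
    · exact ⟨false, inHole_of_sep hd ha hAH hle hext h hxy⟩
    · obtain ⟨h1, h2⟩ := inHole_of_sep hd ha hAH hle hext
        (h.symm_of fun x y => hd.symm x.1 y.1) hxy
      exact ⟨true, h2, h1⟩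
  · intro x y h
    have h : (localData d ε R a i j).mean x + 4 * ε < (localData d ε R a i j).mean y := h
    have hj := x.2.2.1
    obtain ⟨l, hil, hlj, hy⟩ := exists_inHole_xset hle.1 hext ha y
    by_cases hli : l = i
    · exact ⟨false, hli ▸ hy⟩
    by_cases hlj' : l = j - 1
    · exact ⟨true, hlj' ▸ hy⟩
    exfalso
    -- An element of an inner hole `H_l` has the inner chain elements `a_l` before it and `a_{l+1}`
    -- after it, so its mean is bounded by that of `x` on whichever side `x` lies.
    rcases total_of le x.1 y.1 with hxy | hxy
    · have := (bounds_before hd ha hAH hle (m := ⟨l, by omega⟩) (by simp only; omega)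
        (by simp only; omega) hxy ((hy _).2 (by simp only; omega))).2
      linarith
    · have := (bounds_after hd ha hAH hle (m := ⟨l - 1, by omega⟩) (by simp only; omega)
        (by simp only; omega) hxy ((hy _).1 (by simp only; omega))).2
      linarith
  · rintro b x y hx hy ⟨-, h⟩
    have hj := x.2.2.1
    have hij := x.2.2.succ_lt ha x.2.1
    cases b
    · exact (bounds_before hd ha hAH hle (m := ⟨i, by omega⟩) (by simp only; omega)
        (by simp only; omega) h ((hx _).2 (by simp))).2
    · exact (bounds_after hd ha hAH hle (m := ⟨j - 2, by omega⟩) (by simp only; omega)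
        (by simp only; omega) h ((hx _).1 (by simp only [cond_true]; omega))).2
  · rintro b w x y hw hx hy ⟨-, h⟩
    have hj := x.2.2.1
    have hij := x.2.2.succ_lt ha x.2.1
    change d w.1 x.1 ≤ d w.1 y.1 + 2 * ε
    cases b
    · have h1 := (hx ⟨i, by omega⟩).2 (by simp)
      have h2 := (hw ⟨i, by omega⟩).1 (by simp only [Bool.not_false, cond_true]; omega)
      rw [hd.symm w.1 x.1, hd.symm w.1 y.1]
      exact hc _ _ _ _ h (trans_of le h1 h2) (refl_of le _)
    · have h1 := (hw ⟨i, by omega⟩).2 (by simp)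
      have h2 := (hx ⟨i, by omega⟩).1 (by simp only [cond_true]; omega)
      exact hc _ _ _ _ (refl_of le _) (trans_of le h1 h2) h

theorem exists_cellInHole (hd : IsDissimilarity d) (hε : 0 ≤ ε) (ha : IsMaximalChain R a)
    (hAH : BoundingHolesAdmissible d ε R a) (hle : IsCompatibleOrder d ε le)
    (hext : ∀ x y, R x y → le x y) (C : (localData d ε R a i j).Cell) :
    ∃ k, i ≤ k ∧ k < j ∧ CellInHole le C k := by
  obtain ⟨x, rfl⟩ := LocalData.exists_cellOf_eq C
  obtain ⟨k, hik, hkj, hx⟩ := exists_inHole_xset hle.1 hext ha x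
  have P := placement_of_compatible (i := i) (j := j) hd hε ha hAH hle hext
  refine ⟨k, hik, hkj, fun y hy => ?_⟩
  have hlink {x y} := inHole_of_link (x := x) (y := y) hd ha hAH hle hext hik hkj
  have key : ∀ x y, (localData d ε R a i j).SameBlock x y →
      (InHole a le x.1 k ↔ InHole a le y.1 k) := by
    intro x y h
    induction h with
    | rel x y h => exact ⟨hlink h, hlink (P.link_symm h)⟩
    | refl x => rfl
    | symm x y _ ih => exact ih.symm
    | trans x y z _ _ ih ih' => exact ih.trans ih'
  exact (key x y (P.sameBlock_of_cellOf_eq hy.symm)).mp hx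

/-- Cells in inner holes are given the value of those in `H_i`; uniqueness of the hole makes this
consistent. -/
theorem exists_isInducedAssignment (hle : IsLinearOrder X le) (ha : IsMaximalChain R a) :
    ∃ A : (localData d ε R a i j).Cell → Bool, IsInducedAssignment le A := by
  classical
  have hne : ∀ (C : (localData d ε R a i j).Cell) k, CellInHole le C k → k < j - 1 →
      ¬ CellInHole le C (j - 1) := by
    intro C k h hk h'
    obtain ⟨x, hx⟩ := LocalData.exists_cellOf_eq C
    have hj := x.2.2.1
    have := inHole_unique hle x.2.1 (h x hx) (h' x hx) (by omega) (by omega)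
    omega
  refine ⟨fun C => decide (CellInHole le C (j - 1)), fun C h => ?_, fun C h => by simpa using h,
    fun C C' k _ hk h h' => ?_⟩
  · obtain ⟨x, -⟩ := LocalData.exists_cellOf_eq C
    have := x.2.2.succ_lt ha x.2.1
    simpa using hne C i h (by omega)
  · simp [hne C k h hk, hne C' k h' hk]

end Location

end SeriationFit

open SeriationFit
theorem proposition4p10 {X : Type*} [Finite X] (d : X → X → ℝ) (hd : IsDissimilarity d)
    (ε : ℝ) (hε : 0 ≤ ε)
    -- the canonical order, assumed to be a partial order, and a maximal chain
    (R : X → X → Prop) (hR : IsCanonical d ε R) (hpo : IsPartialOrder X R)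
    {p : ℕ} (a : Fin p → X) (ha : IsMaximalChain R a)
    (hAH : BoundingHolesAdmissible d ε R a) (i j : ℕ) :
    -- a satisfying assignment partitions the cell graph into two acyclic induced subgraphs
    ((localData d ε R a i j).NoG3Cycle →
      (∀ K, (localData d ε R a i j).IsCluster K → (localData d ε R a i j).AcyclicOn K) →
      ∀ A : (localData d ε R a i j).Cell → Bool, Satisfies A (localData d ε R a i j).formula →
        IsCompl {C | A C = false} {C | A C = true} ∧
        (localData d ε R a i j).AcyclicOn {C | A C = false} ∧
        (localData d ε R a i j).AcyclicOn {C | A C = true}) ∧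
    -- the two conditions used above hold as soon as an `ε`-compatible order exists
    ((∃ le, IsCompatibleOrder d ε le) →
      (localData d ε R a i j).NoG3Cycle ∧
      ∀ K, (localData d ε R a i j).IsCluster K → (localData d ε R a i j).AcyclicOn K) ∧
    -- every `ε`-compatible order refines the canonical order or its dual
    (∀ le, IsCompatibleOrder d ε le →
      (∀ x y, R x y → le x y) ∨ (∀ x y, R x y → le y x)) ∧
    -- an `ε`-compatible order (directed so that it refines the canonical order) locates every cell
    -- in one hole of `H_{ij}`, and the assignments that it defines satisfy the formula
    (∀ le, IsCompatibleOrder d ε le → (∀ x y, R x y → le x y) →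
      (∀ C : (localData d ε R a i j).Cell, ∃ k, i ≤ k ∧ k < j ∧ CellInHole le C k) ∧
      (∃ A : (localData d ε R a i j).Cell → Bool, IsInducedAssignment le A) ∧
      ∀ A : (localData d ε R a i j).Cell → Bool, IsInducedAssignment le A →
        Satisfies A (localData d ε R a i j).formula) ∧
    -- if the formula is not satisfiable, then there is no `ε`-compatible order
    ((¬ ∃ A : (localData d ε R a i j).Cell → Bool,
        Satisfies A (localData d ε R a i j).formula) →
      ¬ ∃ le, IsCompatibleOrder d ε le) := by
  have hpl : ∀ le, IsCompatibleOrder d ε le → (∀ x y, R x y → le x y) →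
      (∀ C : (localData d ε R a i j).Cell, ∃ k, i ≤ k ∧ k < j ∧ CellInHole le C k) ∧
      (∃ A : (localData d ε R a i j).Cell → Bool, IsInducedAssignment le A) ∧
      ∀ A : (localData d ε R a i j).Cell → Bool, IsInducedAssignment le A →
        Satisfies A (localData d ε R a i j).formula := by
    intro le hle hext
    refine ⟨exists_cellInHole hd hε ha hAH hle hext, exists_isInducedAssignment hle.1 ha, ?_⟩
    intro A hA
    refine (placement_of_compatible hd hε ha hAH hle hext).satisfies fun b C h => ?_
    cases b
    · exact hA.1 C h
    · exact hA.2.1 C h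
  -- The dual of a compatible order is compatible, so one that refines the canonical order can be
  -- chosen.
  have hdir : (∃ le, IsCompatibleOrder d ε le) →
      ∃ le, IsCompatibleOrder d ε le ∧ ∀ x y, R x y → le x y := by
    rintro ⟨le, hle⟩
    rcases hR.refines hd hε hle with h | h
    · exact ⟨le, hle, h⟩
    · exact ⟨_, hle.swap hd, h⟩
  refine ⟨fun hG3 hK A hA => ⟨?_, LocalData.acyclicOn_of_satisfies hG3 hK hA false,
    LocalData.acyclicOn_of_satisfies hG3 hK hA true⟩, fun h => ?_,
    fun le hle => hR.refines hd hε hle, hpl, fun hns h => ?_⟩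
  · have : {C | A C = true} = {C | A C = false}ᶜ := by
      ext C
      simp
    rw [this]
    exact isCompl_compl
  · obtain ⟨le, hle, hext⟩ := hdir h
    have P := placement_of_compatible (i := i) (j := j) hd hε ha hAH hle hext
    exact ⟨P.noG3Cycle, fun K hK => P.acyclicOn_cluster hK⟩
  · obtain ⟨le, hle, hext⟩ := hdir h
    obtain ⟨-, ⟨A, hA⟩, hsat⟩ := hpl le hle hext
    exact hns ⟨A, hsat A hA⟩
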